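/- Let $n\ge 3$. An $n$-dimensional algebra is a bilinear multiplication $\lambda$ on $V=\mathbb{C}^n$ (no identities are assumed), i.e. a point of the affine space $\mathrm{Hom}(V\otimes V,V)\cong\mathbb{C}^{n^3}$, on which $GL_n(\mathbb{C})$ acts by $(g*\lambda)(x,y)=g(\lambda(g^{-1}x,g^{-1}y))$; the orbits $\mathrm{Orb}(\lambda)$ are the isomorphism classes. One says that $\lambda$ degenerates to $\mu$, $\lambda\to\mu$, if $\mathrm{Orb}(\mu)$ lies in the Zariski closure $\overline{\mathrm{Orb}(\lambda)}$; the degeneration is non-trivial if $\lambda\not\cong\mu$, and a non-trivial degeneration $\lambda\to\mu$ is direct if there is no $\nu$ with non-trivial degenerations $\lambda\to\nu$ and $\nu\to\mu$. The level of $\lambda$ is the maximal length (number of arrows) of a chain of direct degenerations starting at $\lambda$. Consider the following $n$-dimensional algebras with basis $e_1,\dots,e_n$, where products not listed are zero: - $a_n$: all products are zero; - $p_n^-$: $e_1e_i=e_i$, $e_ie_1=-e_i$ for $2\le i\le n$; - $n_3^-\oplus a_{n-3}$: $e_1e_2=e_3$, $e_2e_1=-e_3$; - $\lambda_2\oplus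 a_{n-2}$: $e_1e_1=e_2$; - $\nu_n(\alpha)$, $\alpha\in\mathbb{C}$: $e_1e_1=e_1$, $e_1e_i=\alpha e_i$, $e_ie_1=(1-\alpha)e_i$ for $2\le i\le n$. Then: 1. An $n$-dimensional algebra has level one if and only if it is isomorphic to one of $p_n^-$, $n_3^-\oplus a_{n-3}$, $\lambda_2\oplus a_{n-2}$, or $\nu_n(\alpha)$ for some $\alpha\in\mathbb{C}$. 2. No algebra of the list $p_n^-$, $n_3^-\oplus a_{n-3}$, $\lambda_2\oplus a_{n-2}$, $\nu_n(\alpha)$ $(\alpha\in\mathbb{C})$ degenerates to a different member of the list (in particular $\nu_n(\alpha)\not\to\nu_n(\beta)$ for $\alpha\ne\beta$). 3. $\overline{\mathrm{Orb}(p_n^-)}=\mathrm{Orb}(p_n^-)\cup\{a_n\}$, and $\overline{\mathrm{Orb}(\nu_n(\alpha))}=\mathrm{Orb}(\nu_n(\alpha))\cup\{a_n\}$ for every $\alpha\in\mathbb{C}$. -/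

import Mathlib

/-- An `n`-dimensional complex algebra: a bilinear multiplication (no identities are assumed) on
the vector space `V = ℂⁿ`, that is, an element of `Hom(V ⊗ V, V)`. -/
abbrev AlgLaw (n : ℕ) : Type :=
  (Fin n → ℂ) →ₗ[ℂ] (Fin n → ℂ) →ₗ[ℂ] (Fin n → ℂ)

namespace AlgLaw

/-- The action of `GL_n(ℂ)`: `(g * μ)(x, y) = g (μ (g⁻¹ x, g⁻¹ y))`. -/
def act {n : ℕ} (g : (Fin n → ℂ) ≃ₗ[ℂ] (Fin n → ℂ)) (μ : AlgLaw n) : AlgLaw n :=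
  LinearMap.mk₂ ℂ (fun x y => g (μ (g.symm x) (g.symm y)))
    (by intros; simp) (by intros; simp) (by intros; simp) (by intros; simp)

/-- The orbit of `μ`. -/
def orbit {n : ℕ} (μ : AlgLaw n) : Set (AlgLaw n) :=
  {ν | ∃ g : (Fin n → ℂ) ≃ₗ[ℂ] (Fin n → ℂ), ν = act g μ}

/-- Isomorphism of algebras: a multiplicative linear bijection. -/
def Isomorphic {n : ℕ} (μ ν : AlgLaw n) : Prop :=
  ∃ g : (Fin n → ℂ) ≃ₗ[ℂ] (Fin n → ℂ), ∀ x y, g (μ x y) = ν (g x) (g y)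

/-- The standard basis vector with index `k`, counted from `0`. (It is `0` if `k ≥ n`.) -/
def stdVec (n k : ℕ) : Fin n → ℂ := fun m => if m.val = k then 1 else 0

/-- The structure constants: the coefficient of `e_k` in `e_i e_j`. They identify
`Hom(V ⊗ V, V)` with affine space of dimension `n ^ 3`. -/
def coords {n : ℕ} (μ : AlgLaw n) : Fin n × Fin n × Fin n → ℂ :=
  fun p => μ (Pi.single p.1 1) (Pi.single p.2.1 1) p.2.2

/-- The Zariski closure of a set of multiplications: all multiplications at which every
polynomial in the structure constants that vanishes on the set vanishes. -/
def zariskiClosure {n : ℕ} (S : Set (AlgLaw n)) : Set (AlgLaw n) :=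
  coords ⁻¹' MvPolynomial.zeroLocus ℂ (MvPolynomial.vanishingIdeal ℂ (coords '' S))

/-- `μ` degenerates to `ν`: the orbit of `ν` lies in the Zariski closure of the orbit of `μ`. -/
def Degenerates {n : ℕ} (μ ν : AlgLaw n) : Prop :=
  orbit ν ⊆ zariskiClosure (orbit μ)

/-- A degeneration is non-trivial if the two algebras are not isomorphic. -/
def ProperlyDegenerates {n : ℕ} (μ ν : AlgLaw n) : Prop :=
  Degenerates μ ν ∧ ¬ Isomorphic μ ν

/-- A direct degeneration: a non-trivial degeneration `μ → ν` such that there is no chain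
`μ → ρ → ν` of non-trivial degenerations. -/
def DirectlyDegenerates {n : ℕ} (μ ν : AlgLaw n) : Prop :=
  ProperlyDegenerates μ ν ∧
    ¬ ∃ ρ : AlgLaw n, ProperlyDegenerates μ ρ ∧ ProperlyDegenerates ρ ν

/-- The level of an algebra: the maximal length (number of arrows) of a chain
`μ = μ₀ → μ₁ → ⋯ → μₗ` of direct degenerations. -/
noncomputable def level {n : ℕ} (μ : AlgLaw n) : ℕ∞ :=
  ⨆ s : {s : RelSeries {p : AlgLaw n × AlgLaw n | DirectlyDegenerates p.1 p.2} // s.head = μ},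
    (s.1.length : ℕ∞)

/-- The multiplication with table `e_i e_j = c i j` on the standard basis
(indices are counted from `0`). -/
noncomputable def ofTable (n : ℕ) (c : ℕ → ℕ → (Fin n → ℂ)) : AlgLaw n :=
  (Pi.basisFun ℂ (Fin n)).constr ℂ fun i : Fin n =>
    (Pi.basisFun ℂ (Fin n)).constr ℂ fun j : Fin n => c i.val j.val

/-- The abelian algebra `a_n`: all products vanish. -/
def abelian (n : ℕ) : AlgLaw n := 0

/-- `p_n⁻`: `e₁ e_i = e_i`, `e_i e₁ = - e_i` for `i ≥ 2`; all other products vanish. -/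
noncomputable def pMinus (n : ℕ) : AlgLaw n :=
  ofTable n fun i j =>
    if i = 0 ∧ 1 ≤ j then stdVec n j
    else if 1 ≤ i ∧ j = 0 then - stdVec n i
    else 0

/-- `n₃⁻ ⊕ a_{n-3}` (for `n ≥ 3`): `e₁ e₂ = e₃`, `e₂ e₁ = - e₃`; all other products vanish. -/
noncomputable def n3MinusSum (n : ℕ) : AlgLaw n :=
  ofTable n fun i j =>
    if i = 0 ∧ j = 1 then stdVec n 2
    else if i = 1 ∧ j = 0 then - stdVec n 2
    else 0

/-- `λ₂ ⊕ a_{n-2}` (for `n ≥ 2`): `e₁ e₁ = e₂`; all other products vanish. -/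
noncomputable def lambda2Sum (n : ℕ) : AlgLaw n :=
  ofTable n fun i j => if i = 0 ∧ j = 0 then stdVec n 1 else 0

/-- `ν_n(α)`: `e₁ e₁ = e₁`, `e₁ e_i = α e_i`, `e_i e₁ = (1 - α) e_i` for `i ≥ 2`;
all other products vanish. -/
noncomputable def nu (n : ℕ) (α : ℂ) : AlgLaw n :=
  ofTable n fun i j =>
    if i = 0 ∧ j = 0 then stdVec n 0
    else if i = 0 ∧ 1 ≤ j then α • stdVec n j
    else if 1 ≤ i ∧ j = 0 then (1 - α) • stdVec n i
    else 0

/-- Names for the members of the list. -/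
inductive Kind : Type
  | p : Kind
  | n3 : Kind
  | lam2 : Kind
  | nu (α : ℂ) : Kind

/-- The list `p_n⁻`, `n₃⁻ ⊕ a_{n-3}`, `λ₂ ⊕ a_{n-2}`, `ν_n(α)` (`α ∈ ℂ`). -/
noncomputable def model (n : ℕ) : Kind → AlgLaw n
  | Kind.p => pMinus n
  | Kind.n3 => n3MinusSum n
  | Kind.lam2 => lambda2Sum n
  | Kind.nu α => AlgLaw.nu n α

end AlgLaw

/-! Degeneration is a partial order on isomorphism classes with `0` as smallest element. The theorem
says that the minimal nonzero classes are exactly the listed ones, which follows from two facts.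

Every nonzero algebra degenerates to a listed one (`exists_degenerates_model`). If some `x x` is not
a multiple of `x`, a diagonal limit leaves only `e₁ e₁ = e₂`. If all squares are multiples but some
`x y` leaves the span of `x` and `y`, polarization makes the product anticommutative modulo that
span, and a diagonal limit gives `n₃⁻ ⊕ a_{n-3}`. Otherwise `x y = φ(x) y + ψ(y) x`. This case
either loses `ψ` in a limit or already has `φ` and `ψ` proportional, so it ends at `p_n⁻` or some
`ν_n(α)`.

The list is an antichain (`not_degenerates_model`), because a `GL_n`-stable linear subspace
containing `μ` contains every degeneration of `μ`. The subspaces used are the laws `a χ(x) y + b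
χ(y) x` with `a`, `b` fixed, the commutative laws, the anticommutative laws, and the laws with
traceless multiplications.

Antisymmetry is proved without orbit dimensions. The ideal of an orbit closure is the kernel of the
comorphism of the orbit map. If two such kernels agree, the two generic points amalgamate in a
nontrivial ring, and the Nullstellensatz turns this into complex matrices `g`, `k` with `g * μ = k *
ν`. These ideals are prime, so heights increase strictly along proper degenerations, which supplies
direct degenerations. -/

open Filter Topology MvPolynomial

/-! ### Orbits, Zariski closures and limits -/

namespace AlgLaw

variable {n : ℕ}

@[simp] theorem act_apply (g : (Fin n → ℂ) ≃ₗ[ℂ] (Fin n → ℂ)) (μ : AlgLaw n) (x y : Fin n → ℂ) :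
    act g μ x y = g (μ (g.symm x) (g.symm y)) := rfl

theorem act_act (g h : (Fin n → ℂ) ≃ₗ[ℂ] (Fin n → ℂ)) (μ : AlgLaw n) :
    act g (act h μ) = act (h.trans g) μ := rfl

theorem mem_orbit_self (μ : AlgLaw n) : μ ∈ orbit μ := ⟨LinearEquiv.refl ℂ _, rfl⟩

theorem act_mem_orbit (g : (Fin n → ℂ) ≃ₗ[ℂ] (Fin n → ℂ)) {μ ν : AlgLaw n} (h : ν ∈ orbit μ) :
    act g ν ∈ orbit μ := by
  obtain ⟨k, rfl⟩ := h
  exact ⟨k.trans g, act_act g k μ⟩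

theorem mem_orbit_symm {μ ν : AlgLaw n} (h : ν ∈ orbit μ) : μ ∈ orbit ν := by
  obtain ⟨k, rfl⟩ := h
  exact ⟨k.symm, by ext; simp⟩

theorem orbit_subset_of_mem {μ ν : AlgLaw n} (h : ν ∈ orbit μ) : orbit ν ⊆ orbit μ := by
  rintro _ ⟨k, rfl⟩
  exact act_mem_orbit k h

theorem orbit_eq_of_mem {μ ν : AlgLaw n} (h : ν ∈ orbit μ) : orbit ν = orbit μ :=
  (orbit_subset_of_mem h).antisymm (orbit_subset_of_mem (mem_orbit_symm h))

theorem isomorphic_iff_mem_orbit {μ ν : AlgLaw n} : Isomorphic μ ν ↔ ν ∈ orbit μ := by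
  constructor
  · rintro ⟨g, hg⟩
    refine ⟨g, LinearMap.ext₂ fun x y => ?_⟩
    simp [hg]
  · rintro ⟨g, rfl⟩
    exact ⟨g, fun x y => by simp⟩

theorem isomorphic_iff_orbit_eq {μ ν : AlgLaw n} : Isomorphic μ ν ↔ orbit μ = orbit ν :=
  isomorphic_iff_mem_orbit.trans
    ⟨fun h => (orbit_eq_of_mem h).symm, fun h => h ▸ mem_orbit_self ν⟩

@[simp] theorem orbit_zero : orbit (0 : AlgLaw n) = {0} := by
  ext μ
  constructor
  · rintro ⟨g, rfl⟩
    exact LinearMap.ext₂ fun x y => by simp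
  · rintro rfl
    exact mem_orbit_self 0

/-- The action of a fixed element of `GL_n` as a linear map. -/
def actLinear (g : (Fin n → ℂ) ≃ₗ[ℂ] (Fin n → ℂ)) : AlgLaw n →ₗ[ℂ] AlgLaw n where
  toFun := act g
  map_add' μ ν := LinearMap.ext₂ fun x y => by simp
  map_smul' c μ := LinearMap.ext₂ fun x y => by simp

/-- The structure constants as a linear map. -/
def coordsLinear (n : ℕ) : AlgLaw n →ₗ[ℂ] (Fin n × Fin n × Fin n → ℂ) where
  toFun := coords
  map_add' μ ν := by ext; simp [coords]
  map_smul' c μ := by ext; simp [coords]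

theorem coords_injective : Function.Injective (coords (n := n)) := by
  intro μ ν h
  refine LinearMap.pi_ext' fun i => LinearMap.ext_ring <| LinearMap.pi_ext' fun j =>
    LinearMap.ext_ring ?_
  funext k
  exact congrFun h (i, j, k)

theorem mem_zariskiClosure {S : Set (AlgLaw n)} {μ : AlgLaw n} :
    μ ∈ zariskiClosure S ↔ ∀ f : MvPolynomial (Fin n × Fin n × Fin n) ℂ,
      (∀ ν ∈ S, eval (coords ν) f = 0) → eval (coords μ) f = 0 := by
  simp [zariskiClosure, aeval_eq_eval]

theorem subset_zariskiClosure (S : Set (AlgLaw n)) : S ⊆ zariskiClosure S :=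
  fun μ hμ => mem_zariskiClosure.2 fun _ hf => hf μ hμ

theorem zariskiClosure_subset {S T : Set (AlgLaw n)} (h : S ⊆ zariskiClosure T) :
    zariskiClosure S ⊆ zariskiClosure T := fun _ hμ =>
  mem_zariskiClosure.2 fun f hf => mem_zariskiClosure.1 hμ f fun _ hν =>
    mem_zariskiClosure.1 (h hν) f hf

/-- Every linear functional on the space of multiplications is a polynomial in the structure
constants. -/
theorem exists_polynomial_of_linear (l : AlgLaw n →ₗ[ℂ] ℂ) :
    ∃ f : MvPolynomial (Fin n × Fin n × Fin n) ℂ, ∀ μ, eval (coords μ) f = l μ := by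
  have hker : LinearMap.ker (coordsLinear n) = ⊥ :=
    LinearMap.ker_eq_bot'.2 fun μ hμ => coords_injective (hμ.trans (map_zero (coordsLinear n)).symm)
  obtain ⟨r, hr⟩ := LinearMap.exists_leftInverse_of_injective (K := ℂ) (V := AlgLaw n)
    (V' := Fin n × Fin n × Fin n → ℂ) (coordsLinear n) hker
  -- Since `r` is a left inverse of `coords`, `l` is the linear form `l ∘ r` in the structure
  -- constants.
  refine ⟨∑ p, X p * C (l (r (Pi.single p 1))), fun μ => ?_⟩
  have h1 : l μ = (l ∘ₗ r) (coords μ) := by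
    have := LinearMap.congr_fun hr μ
    simp only [LinearMap.comp_apply, LinearMap.id_apply] at this
    conv_lhs => rw [← this]
    rfl
  rw [h1, LinearMap.pi_apply_eq_sum_univ (l ∘ₗ r) (coords μ)]
  simp only [map_sum, map_mul, eval_X, eval_C, smul_eq_mul, LinearMap.comp_apply]
  refine Finset.sum_congr rfl fun p _ => ?_
  congr 4
  funext q
  simp [Pi.single_apply, eq_comm]

/-- Linear subspaces are Zariski closed. -/
theorem zariskiClosure_subset_submodule {S : Set (AlgLaw n)} (W : Submodule ℂ (AlgLaw n))
    (h : S ⊆ W) : zariskiClosure S ⊆ W := by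
  intro μ hμ
  by_contra hW
  obtain ⟨l, hl, hlW⟩ := Submodule.exists_le_ker_of_notMem (p := W) (v := μ) hW
  obtain ⟨f, hf⟩ := exists_polynomial_of_linear l
  exact hl ((hf μ).symm.trans (mem_zariskiClosure.1 hμ f fun ν hν =>
    (hf ν).trans (hlW (h hν))))

/-- The action of a fixed `g` is linear in the structure constants, so substituting it into a
polynomial vanishing on the orbit gives another such polynomial. -/
theorem act_mem_zariskiClosure_orbit (g : (Fin n → ℂ) ≃ₗ[ℂ] (Fin n → ℂ)) {μ ν : AlgLaw n}
    (h : ν ∈ zariskiClosure (orbit μ)) : act g ν ∈ zariskiClosure (orbit μ) := by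
  rw [mem_zariskiClosure] at h ⊢
  intro f hf
  choose F hF using fun p : Fin n × Fin n × Fin n =>
    exists_polynomial_of_linear ((LinearMap.proj p) ∘ₗ coordsLinear n ∘ₗ actLinear g)
  have key : ∀ ρ : AlgLaw n, eval (coords ρ) (bind₁ F f) = eval (coords (act g ρ)) f := by
    intro ρ
    rw [← aeval_eq_eval, aeval_bind₁, ← aeval_eq_eval]
    congr 2
    funext p
    exact hF p ρ
  rw [← key]
  exact h _ fun ρ hρ => (key ρ).trans (hf _ (act_mem_orbit g hρ))

theorem degenerates_iff {μ ν : AlgLaw n} :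
    Degenerates μ ν ↔ ν ∈ zariskiClosure (orbit μ) := by
  refine ⟨fun h => h (mem_orbit_self ν), ?_⟩
  rintro h _ ⟨g, rfl⟩
  exact act_mem_zariskiClosure_orbit g h

theorem Degenerates.trans {μ ν ρ : AlgLaw n} (h : Degenerates μ ν) (h' : Degenerates ν ρ) :
    Degenerates μ ρ :=
  Set.Subset.trans h' (zariskiClosure_subset h)

theorem Isomorphic.degenerates {μ ν : AlgLaw n} (h : Isomorphic μ ν) : Degenerates μ ν :=
  degenerates_iff.2 (subset_zariskiClosure _ (isomorphic_iff_mem_orbit.1 h))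

theorem Isomorphic.symm {μ ν : AlgLaw n} (h : Isomorphic μ ν) : Isomorphic ν μ :=
  isomorphic_iff_orbit_eq.2 (isomorphic_iff_orbit_eq.1 h).symm

/-- A limit, as `t → 0`, of multiplications isomorphic to `μ` is a degeneration of `μ`. -/
theorem Degenerates.of_tendsto {μ ν : AlgLaw n} (γ : ℂ → AlgLaw n)
    (hγ : ∀ t, t ≠ 0 → γ t ∈ orbit μ)
    (hlim : ∀ p, Tendsto (fun t => coords (γ t) p) (𝓝[≠] 0) (𝓝 (coords ν p))) :
    Degenerates μ ν := by
  refine degenerates_iff.2 (mem_zariskiClosure.2 fun f hf => ?_)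
  have h1 : Tendsto (fun t => eval (coords (γ t)) f) (𝓝[≠] 0) (𝓝 (eval (coords ν) f)) :=
    ((MvPolynomial.continuous_eval f).tendsto _).comp (tendsto_pi_nhds.2 hlim)
  refine tendsto_nhds_unique h1 (tendsto_const_nhds.congr' ?_)
  filter_upwards [self_mem_nhdsWithin] with t ht
  exact (hf _ (hγ t ht)).symm

theorem degenerates_zero (μ : AlgLaw n) : Degenerates μ 0 := by
  refine Degenerates.of_tendsto (fun t => t • μ) (fun t ht => ?_) fun p => ?_
  -- The scalar `t⁻¹` multiplies a bilinear law by `t⁻¹ * t ^ 2 = t`.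
  · refine ⟨LinearEquiv.smulOfUnit (Units.mk0 t⁻¹ (inv_ne_zero ht)), LinearMap.ext₂ fun x y => ?_⟩
    simp [LinearEquiv.smulOfUnit, Units.smul_def, smul_smul, ht]
  · have : Tendsto (fun t : ℂ => t * coords μ p) (𝓝[≠] 0) (𝓝 (0 * coords μ p)) :=
      ((continuous_id.mul continuous_const).tendsto 0).mono_left nhdsWithin_le_nhds
    simpa [coords] using this

theorem Degenerates.eq_zero {ν : AlgLaw n} (h : Degenerates 0 ν) : ν = 0 := by
  have := zariskiClosure_subset_submodule (S := orbit (0 : AlgLaw n)) ⊥ (by simp)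
    (degenerates_iff.1 h)
  simpa using this

end AlgLaw

/-! ### Amalgamation and the Nullstellensatz -/

/-- Two homomorphisms into domains with the same kernel can be amalgamated in a nontrivial ring. -/
theorem RingHom.exists_amalgam {R A B : Type} [CommRing R] [CommRing A] [CommRing B] [IsDomain A]
    [IsDomain B] (φ : R →+* A) (ψ : R →+* B) (h : RingHom.ker φ = RingHom.ker ψ) :
    ∃ (T : Type) (_ : CommRing T) (_ : Nontrivial T) (a : A →+* T) (b : B →+* T),
      a.comp φ = b.comp ψ := by
  let φ' : R ⧸ RingHom.ker φ →+* A := RingHom.kerLift φ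
  let ψ' : R ⧸ RingHom.ker φ →+* B := Ideal.Quotient.lift _ ψ fun x hx => by rwa [h] at hx
  let := φ'.toAlgebra
  let := ψ'.toAlgebra
  have hφ : Function.Injective (algebraMap (R ⧸ RingHom.ker φ) A) := RingHom.kerLift_injective φ
  have hψ : Function.Injective (algebraMap (R ⧸ RingHom.ker φ) B) :=
    RingHom.lift_injective_of_ker_le_ideal _ _ h.ge
  -- The common image embeds in both domains, which keeps the tensor product over it nontrivial.
  refine ⟨TensorProduct (R ⧸ RingHom.ker φ) A B, inferInstance,
    Algebra.TensorProduct.nontrivial_of_algebraMap_injective_of_isDomain _ A B hφ hψ,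
    Algebra.TensorProduct.includeLeftRingHom,
    Algebra.TensorProduct.includeRight.toRingHom, RingHom.ext fun x => ?_⟩
  exact (Algebra.TensorProduct.algebraMap_apply (Ideal.Quotient.mk _ x)).symm.trans
    (Algebra.TensorProduct.algebraMap_apply' (Ideal.Quotient.mk _ x))

/-- A finite system of polynomial equations that is solvable in some nontrivial algebra over an
algebraically closed field is solvable in the field. -/
theorem MvPolynomial.exists_point_of_algebra {k σ T : Type*} [Field k] [IsAlgClosed k] [Finite σ]
    [CommRing T] [Nontrivial T] [Algebra k T] (x : σ → T) :
    ∃ y : σ → k, ∀ p q : MvPolynomial σ k, aeval x p = aeval x q → eval y p = eval y q := by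
  have hI : (RingHom.ker (aeval (R := k) x)) ≠ ⊤ := RingHom.ker_ne_top _
  obtain ⟨m, hm, hle⟩ := Ideal.exists_le_maximal _ hI
  obtain ⟨y, rfl⟩ := isMaximal_iff_eq_vanishingIdeal_singleton.1 hm
  refine ⟨y, fun p q hpq => ?_⟩
  have : p - q ∈ RingHom.ker (aeval (R := k) x) := by
    rw [RingHom.mem_ker, map_sub, hpq, sub_self]
  have := (mem_vanishingIdeal_singleton_iff y _).1 (hle this)
  rwa [map_sub, sub_eq_zero] at this

/-! ### Orbit ideals and antisymmetry of degeneration -/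

namespace AlgLaw

variable {n : ℕ}

/-- The structure constants `c` after the change of basis given by `M`, with inverse `N`. -/
def conjCoords {T : Type*} [CommRing T] (M N : Matrix (Fin n) (Fin n) T)
    (c : Fin n × Fin n × Fin n → T) : Fin n × Fin n × Fin n → T :=
  fun p => ∑ l, ∑ b, ∑ a, M p.2.2 l * N a p.1 * N b p.2.1 * c (a, b, l)

theorem map_conjCoords {T T' : Type*} [CommRing T] [CommRing T'] (φ : T →+* T')
    (M N : Matrix (Fin n) (Fin n) T) (c : Fin n × Fin n × Fin n → T) (p : Fin n × Fin n × Fin n) :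
    φ (conjCoords M N c p) = conjCoords (M.map φ) (N.map φ) (φ ∘ c) p := by
  simp [conjCoords]

theorem coords_act (g : (Fin n → ℂ) ≃ₗ[ℂ] (Fin n → ℂ)) (M N : Matrix (Fin n) (Fin n) ℂ)
    (hM : ∀ x, g x = M.mulVec x) (hN : ∀ x, g.symm x = N.mulVec x) (μ : AlgLaw n) :
    coords (act g μ) = conjCoords M N (coords μ) := by
  funext p
  have h1 : ∀ j, N.mulVec (Pi.single j 1) = ∑ a, N a j • Pi.single a (1 : ℂ) := fun j => by
    funext a
    simp [Finset.sum_apply, Pi.single_apply]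
  simp only [coords, act_apply, hM, hN, h1, map_sum, map_smul, LinearMap.sum_apply,
    LinearMap.smul_apply, conjCoords]
  simp only [Finset.sum_apply, Pi.smul_apply, smul_eq_mul,
    Matrix.mulVec, dotProduct, Finset.mul_sum]
  refine Finset.sum_congr rfl fun l _ => Finset.sum_congr rfl fun b _ =>
    Finset.sum_congr rfl fun a _ => by ring

/-- The coordinate ring of `GL_n`. -/
abbrev GLRing (n : ℕ) : Type :=
  Localization.Away (Matrix.mvPolynomialX (Fin n) (Fin n) ℂ).det

instance : IsDomain (GLRing n) :=
  IsLocalization.isDomain_localization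
    (powers_le_nonZeroDivisors_of_noZeroDivisors (Matrix.det_mvPolynomialX_ne_zero (Fin n) ℂ))

/-- The generic invertible matrix. -/
noncomputable def genericMatrix (n : ℕ) : Matrix (Fin n) (Fin n) (GLRing n) :=
  (Matrix.mvPolynomialX (Fin n) (Fin n) ℂ).map (algebraMap _ (GLRing n))

theorem isUnit_det_genericMatrix : IsUnit (genericMatrix n).det := by
  have : (genericMatrix n).det =
      algebraMap _ (GLRing n) (Matrix.mvPolynomialX (Fin n) (Fin n) ℂ).det :=
    (RingHom.map_det _ _).symm
  rw [this]
  exact IsLocalization.Away.algebraMap_isUnit _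

theorem isUnit_eval_det (M : GL (Fin n) ℂ) :
    IsUnit (eval (fun ij : Fin n × Fin n => (M : Matrix (Fin n) (Fin n) ℂ) ij.1 ij.2)
      (Matrix.mvPolynomialX (Fin n) (Fin n) ℂ).det) := by
  rw [Matrix.eval_det_mvPolynomialX]
  exact (Matrix.isUnit_iff_isUnit_det _).1 M.isUnit

/-- Evaluation of a regular function on `GL_n` at an invertible matrix. -/
noncomputable def evalGL (M : GL (Fin n) ℂ) : GLRing n →+* ℂ :=
  IsLocalization.Away.lift _ (isUnit_eval_det M)

theorem evalGL_algebraMap (M : GL (Fin n) ℂ) (p : MvPolynomial (Fin n × Fin n) ℂ) :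
    evalGL M (algebraMap _ (GLRing n) p) =
      eval (fun ij : Fin n × Fin n => (M : Matrix (Fin n) (Fin n) ℂ) ij.1 ij.2) p :=
  IsLocalization.Away.lift_eq _ (isUnit_eval_det M) p

theorem evalGL_scalar (M : GL (Fin n) ℂ) (z : ℂ) : evalGL M (algebraMap ℂ (GLRing n) z) = z := by
  rw [IsScalarTower.algebraMap_apply ℂ (MvPolynomial (Fin n × Fin n) ℂ) (GLRing n),
    evalGL_algebraMap]
  simp

theorem genericMatrix_map_evalGL (M : GL (Fin n) ℂ) : (genericMatrix n).map (evalGL M) = M := by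
  ext i j
  simp [genericMatrix, evalGL_algebraMap]

theorem genericMatrix_inv_map_evalGL (M : GL (Fin n) ℂ) :
    ((genericMatrix n)⁻¹).map (evalGL M) = (M : Matrix (Fin n) (Fin n) ℂ)⁻¹ := by
  refine (Matrix.inv_eq_left_inv ?_).symm
  have h := congrArg (fun A : Matrix (Fin n) (Fin n) (GLRing n) => A.map (evalGL M))
    (Matrix.nonsing_inv_mul _ (isUnit_det_genericMatrix (n := n)))
  simp only [Matrix.map_mul, genericMatrix_map_evalGL] at h
  rw [h]
  exact Matrix.map_one _ (map_zero _) (map_one _)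

/-- After clearing the power of the determinant, a polynomial vanishing at all invertible matrices
remains, and it is zero. -/
theorem eq_zero_of_evalGL_eq_zero {s : GLRing n} (h : ∀ M, evalGL M s = 0) : s = 0 := by
  obtain ⟨m, p, hp⟩ := IsLocalization.Away.surj (Matrix.mvPolynomialX (Fin n) (Fin n) ℂ).det s
  have hp0 : p = 0 := eq_of_eval_eq_on_gl fun M => by
    rw [← evalGL_algebraMap, ← hp, map_mul, h, zero_mul, map_zero]
  rw [hp0, map_zero] at hp
  exact (mul_eq_zero.1 hp).resolve_right
    ((IsLocalization.Away.algebraMap_isUnit _).pow m).ne_zero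

/-- The homomorphism of coordinate rings dual to the orbit map `g ↦ g * μ`. -/
noncomputable def orbitComap (μ : AlgLaw n) :
    MvPolynomial (Fin n × Fin n × Fin n) ℂ →ₐ[ℂ] GLRing n :=
  aeval (conjCoords (genericMatrix n) (genericMatrix n)⁻¹ (algebraMap ℂ (GLRing n) ∘ coords μ))

/-- The linear automorphism given by an invertible matrix. -/
noncomputable def glEquiv (M : GL (Fin n) ℂ) : (Fin n → ℂ) ≃ₗ[ℂ] (Fin n → ℂ) :=
  Matrix.toLin'OfInv (M := (M : Matrix (Fin n) (Fin n) ℂ)⁻¹)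
    (M' := (M : Matrix (Fin n) (Fin n) ℂ)) (by simp) (by simp)

theorem coords_act_glEquiv (M : GL (Fin n) ℂ) (μ : AlgLaw n) :
    coords (act (glEquiv M) μ) =
      conjCoords (M : Matrix (Fin n) (Fin n) ℂ) (M : Matrix (Fin n) (Fin n) ℂ)⁻¹ (coords μ) :=
  coords_act _ _ _ (fun x => by simp [glEquiv, Matrix.toLin'OfInv])
    (fun x => by simp [glEquiv, Matrix.toLin'OfInv]) μ

theorem exists_glEquiv (g : (Fin n → ℂ) ≃ₗ[ℂ] (Fin n → ℂ)) : ∃ M, glEquiv M = g := by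
  have h1 : LinearMap.toMatrix' (g : (Fin n → ℂ) →ₗ[ℂ] (Fin n → ℂ)) *
      LinearMap.toMatrix' (g.symm : (Fin n → ℂ) →ₗ[ℂ] (Fin n → ℂ)) = 1 := by
    rw [← LinearMap.toMatrix'_comp]; simp
  refine ⟨⟨LinearMap.toMatrix' g, LinearMap.toMatrix' g.symm, h1, mul_eq_one_comm.1 h1⟩, ?_⟩
  ext1 x
  simp [glEquiv, Matrix.toLin'OfInv]

theorem evalGL_orbitComap (M : GL (Fin n) ℂ) (μ : AlgLaw n)
    (f : MvPolynomial (Fin n × Fin n × Fin n) ℂ) :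
    evalGL M (orbitComap μ f) = eval (coords (act (glEquiv M) μ)) f := by
  induction f using MvPolynomial.induction_on with
  | C a => simp [orbitComap, evalGL_scalar]
  | add p q hp hq => simp [hp, hq]
  | mul_X p i hp =>
    rw [map_mul, map_mul, map_mul, hp, eval_X, coords_act_glEquiv, orbitComap, aeval_X,
      map_conjCoords, genericMatrix_map_evalGL, genericMatrix_inv_map_evalGL]
    congr 2
    funext q
    simp [evalGL_scalar]

/-- The ideal of the closure of the orbit of `μ`. -/
noncomputable def orbitIdeal (μ : AlgLaw n) : Ideal (MvPolynomial (Fin n × Fin n × Fin n) ℂ) :=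
  RingHom.ker (orbitComap μ)

instance (μ : AlgLaw n) : (orbitIdeal μ).IsPrime := RingHom.ker_isPrime _

theorem mem_orbitIdeal {μ : AlgLaw n} {f : MvPolynomial (Fin n × Fin n × Fin n) ℂ} :
    f ∈ orbitIdeal μ ↔ ∀ ν ∈ orbit μ, eval (coords ν) f = 0 := by
  rw [orbitIdeal, RingHom.mem_ker]
  constructor
  · rintro h _ ⟨g, rfl⟩
    obtain ⟨M, rfl⟩ := exists_glEquiv g
    rw [← evalGL_orbitComap, h, map_zero]
  · exact fun h => eq_zero_of_evalGL_eq_zero fun M =>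
      (evalGL_orbitComap M μ f).trans (h _ ⟨_, rfl⟩)

theorem degenerates_iff_orbitIdeal_le {μ ν : AlgLaw n} :
    Degenerates μ ν ↔ orbitIdeal μ ≤ orbitIdeal ν := by
  constructor
  · exact fun h f hf => mem_orbitIdeal.2 fun ρ hρ =>
      mem_zariskiClosure.1 (h hρ) f (mem_orbitIdeal.1 hf)
  · exact fun h ρ hρ => mem_zariskiClosure.2 fun f hf =>
      mem_orbitIdeal.1 (h (mem_orbitIdeal.2 hf)) ρ hρ

/-- In the amalgam `T` the two generic translates of `μ` and `ν` coincide. This is a polynomial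
system in the entries of two matrices and their inverses, solvable over `T` and therefore over `ℂ`.
-/
theorem isomorphic_of_orbitIdeal_eq {μ ν : AlgLaw n} (h : orbitIdeal μ = orbitIdeal ν) :
    Isomorphic μ ν := by
  obtain ⟨T, _, _, a, b, hab⟩ := RingHom.exists_amalgam (orbitComap μ).toRingHom
    (orbitComap ν).toRingHom h
  let : Algebra ℂ T := (a.comp (algebraMap ℂ (GLRing n))).toAlgebra
  have ha : a.comp (algebraMap ℂ (GLRing n)) = algebraMap ℂ T := rfl
  have hb : b.comp (algebraMap ℂ (GLRing n)) = algebraMap ℂ T := by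
    ext z
    have := RingHom.congr_fun hab (C z)
    simpa [orbitComap, RingHom.algebraMap_toAlgebra, aeval_C] using this.symm
  let G : Fin 4 → Matrix (Fin n) (Fin n) T :=
    ![(genericMatrix n).map a, ((genericMatrix n)⁻¹).map a,
      (genericMatrix n).map b, ((genericMatrix n)⁻¹).map b]
  obtain ⟨y, hy⟩ := MvPolynomial.exists_point_of_algebra (k := ℂ)
    (fun p : Fin 4 × Fin n × Fin n => G p.1 p.2.1 p.2.2)
  let Y : Fin 4 → Matrix (Fin n) (Fin n) (MvPolynomial (Fin 4 × Fin n × Fin n) ℂ) :=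
    fun r i j => X (r, i, j)
  let Z : Fin 4 → Matrix (Fin n) (Fin n) ℂ := fun r i j => y (r, i, j)
  have hYG : ∀ r, (Y r).map (aeval (R := ℂ) fun p : Fin 4 × Fin n × Fin n => G p.1 p.2.1 p.2.2)
      = G r := fun r => by ext i j; exact aeval_X _ _
  have hYZ : ∀ r, (Y r).map (eval y) = Z r := fun r => by ext i j; exact eval_X _
  -- Being mutually inverse is part of the polynomial system, so the specialized matrices are still
  -- invertible.
  have hmul : ∀ r s, G r * G s = 1 → Z r * Z s = 1 := by
    intro r s hrs
    have : (Y r * Y s).map (eval y) =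
        (1 : Matrix (Fin n) (Fin n) (MvPolynomial (Fin 4 × Fin n × Fin n) ℂ)).map (eval y) := by
      ext i j
      refine hy _ _ ?_
      have h2 : (Y r * Y s).map (aeval (R := ℂ) fun p : Fin 4 × Fin n × Fin n =>
          G p.1 p.2.1 p.2.2) = Matrix.map 1 (aeval (R := ℂ) fun p : Fin 4 × Fin n × Fin n =>
          G p.1 p.2.1 p.2.2) := by
        rw [Matrix.map_mul, hYG, hYG, hrs, Matrix.map_one _ (map_zero _) (map_one _)]
      exact congrFun (congrFun h2 i) j
    rwa [Matrix.map_mul, hYZ, hYZ, Matrix.map_one _ (map_zero _) (map_one _)] at this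
  have hG : ∀ (c : GLRing n →+* T),
      (genericMatrix n).map c * ((genericMatrix n)⁻¹).map c = 1 := fun c => by
    rw [← Matrix.map_mul, Matrix.mul_nonsing_inv _ isUnit_det_genericMatrix,
      Matrix.map_one _ (map_zero _) (map_one _)]
  have h01 : Z 0 * Z 1 = 1 := hmul 0 1 (hG a)
  have h23 : Z 2 * Z 3 = 1 := hmul 2 3 (hG b)
  let g := Matrix.toLin'OfInv (mul_eq_one_comm.1 h01) h01
  let k := Matrix.toLin'OfInv (mul_eq_one_comm.1 h23) h23
  have hgk : act g μ = act k ν := by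
    refine coords_injective ?_
    rw [coords_act g (Z 0) (Z 1) (fun x => by simp [g, Matrix.toLin'OfInv])
      (fun x => by simp [g, Matrix.toLin'OfInv]),
      coords_act k (Z 2) (Z 3) (fun x => by simp [k, Matrix.toLin'OfInv])
      (fun x => by simp [k, Matrix.toLin'OfInv])]
    funext p
    have h3 := hy (conjCoords (Y 0) (Y 1) (C ∘ coords μ) p)
      (conjCoords (Y 2) (Y 3) (C ∘ coords ν) p) ?_
    · rw [map_conjCoords, map_conjCoords, hYZ, hYZ, hYZ, hYZ] at h3
      have hc : ∀ c : Fin n × Fin n × Fin n → ℂ, eval y ∘ C ∘ c = c := fun c =>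
        funext fun _ => eval_C _
      rwa [hc, hc] at h3
    · have h4 := RingHom.congr_fun hab (X p)
      simp only [orbitComap, RingHom.comp_apply, AlgHom.toRingHom_eq_coe, RingHom.coe_coe, aeval_X,
        map_conjCoords] at h4
      have h5 : ∀ r s c, aeval (fun p : Fin 4 × Fin n × Fin n => G p.1 p.2.1 p.2.2)
          (conjCoords (Y r) (Y s) c p) = conjCoords (G r) (G s)
            (aeval (R := ℂ) (fun p : Fin 4 × Fin n × Fin n => G p.1 p.2.1 p.2.2) ∘ c) p :=
        fun r s c => by
          rw [← hYG r, ← hYG s]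
          exact map_conjCoords (aeval (R := ℂ)
            (fun p : Fin 4 × Fin n × Fin n => G p.1 p.2.1 p.2.2)).toRingHom _ _ _ _
      have h6 : aeval (R := ℂ) (fun p : Fin 4 × Fin n × Fin n => G p.1 p.2.1 p.2.2) ∘ C ∘ coords μ =
          a ∘ algebraMap ℂ (GLRing n) ∘ coords μ := by
        funext q
        simp only [Function.comp_apply, aeval_C, ← ha, RingHom.comp_apply]
      have h7 : aeval (R := ℂ) (fun p : Fin 4 × Fin n × Fin n => G p.1 p.2.1 p.2.2) ∘ C ∘ coords ν =
          b ∘ algebraMap ℂ (GLRing n) ∘ coords ν := by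
        funext q
        simp only [Function.comp_apply, aeval_C, ← hb, RingHom.comp_apply]
      rw [h5, h5, h6, h7]
      exact h4
  exact isomorphic_iff_orbit_eq.2
    ((orbit_eq_of_mem ⟨g, rfl⟩).symm.trans ((congrArg orbit hgk).trans (orbit_eq_of_mem ⟨k, rfl⟩)))

/-- Degeneration is a partial order on isomorphism classes. -/
theorem Degenerates.isomorphic {μ ν : AlgLaw n} (h : Degenerates μ ν) (h' : Degenerates ν μ) :
    Isomorphic μ ν :=
  isomorphic_of_orbitIdeal_eq
    ((degenerates_iff_orbitIdeal_le.1 h).antisymm (degenerates_iff_orbitIdeal_le.1 h'))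

theorem ProperlyDegenerates.height_lt {μ ν : AlgLaw n} (h : ProperlyDegenerates μ ν) :
    (orbitIdeal μ).height < (orbitIdeal ν).height :=
  Ideal.height_strict_mono_of_isPrime <| (degenerates_iff_orbitIdeal_le.1 h.1).lt_of_ne
    fun he => h.2 (isomorphic_of_orbitIdeal_eq he)

/-- A proper degeneration whose orbit ideal has least height is direct: an intermediate algebra
would have smaller height. -/
theorem exists_directlyDegenerates {μ ν : AlgLaw n} (h : ProperlyDegenerates μ ν) :
    ∃ ρ, DirectlyDegenerates μ ρ := by
  obtain ⟨ρ, hρ, hmin⟩ := (InvImage.wf (fun ρ : AlgLaw n => (orbitIdeal ρ).height)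
    wellFounded_lt).has_min {ρ | ProperlyDegenerates μ ρ} ⟨ν, h⟩
  exact ⟨ρ, hρ, fun ⟨σ, h1, h2⟩ => hmin σ h1 h2.height_lt⟩

end AlgLaw

/-! ### Transitivity of the general linear group -/

/-- The general linear group acts transitively on linearly independent families. -/
theorem LinearIndependent.exists_linearEquiv_apply_eq {K V ι : Type*} [Field K] [AddCommGroup V]
    [Module K V] [FiniteDimensional K V] {u v : ι → V} (hu : LinearIndependent K u)
    (hv : LinearIndependent K v) : ∃ g : V ≃ₗ[K] V, ∀ i, g (u i) = v i := by
  obtain ⟨g, hg⟩ := Submodule.exists_linearEquiv_restrict_eq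
    (hu.linearCombinationEquiv.symm ≪≫ₗ hv.linearCombinationEquiv)
  refine ⟨g, fun i => ?_⟩
  have h1 : (hu.linearCombinationEquiv (Finsupp.single i 1) : V) = u i := by simp
  have h2 : (hv.linearCombinationEquiv (Finsupp.single i 1) : V) = v i := by simp
  rw [← h1, ← hg, ← h2]
  simp

/-- The general linear group acts transitively on nonzero linear functionals. -/
theorem Module.Dual.exists_linearEquiv_comp_eq {K V : Type*} [Field K] [AddCommGroup V]
    [Module K V] [FiniteDimensional K V] {φ χ : Module.Dual K V} (hφ : φ ≠ 0) (hχ : χ ≠ 0) :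
    ∃ g : V ≃ₗ[K] V, ∀ v, φ (g v) = χ v := by
  have key : ∀ f : Module.Dual K V, f ≠ 0 → ∃ x, f x = 1 := fun f hf => by
    obtain ⟨x, hx⟩ : ∃ x, f x ≠ 0 := by
      by_contra! h
      exact hf (LinearMap.ext h)
    exact ⟨(f x)⁻¹ • x, by simp [hx]⟩
  obtain ⟨x, hx⟩ := key φ hφ
  obtain ⟨y, hy⟩ := key χ hχ
  have hx0 : x ≠ 0 := by rintro rfl; simp at hx
  have hy0 : y ≠ 0 := by rintro rfl; simp at hy
  obtain ⟨k, hk⟩ := (LinearIndependent.of_subsingleton (v := fun _ : Unit => y) () hy0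
    (R := K)).exists_linearEquiv_apply_eq (LinearIndependent.of_subsingleton
      (v := fun _ : Unit => x) () hx0)
  have hs : (χ - φ.comp (k : V →ₗ[K] V)) y = 0 := by simp [hk (), hx, hy]
  -- As `k` sends `y` to `x`, moving `v` along `y` by the defect `χ - φ ∘ k` corrects the
  -- functional. The defect vanishes at `y`, so this is a transvection.
  refine ⟨(LinearEquiv.transvection hs).trans k, fun v => ?_⟩
  simp [LinearMap.transvection.apply, hk (), hx]

/-! ### The laws `φ(x) y + ψ(y) x` and explicit limits -/

namespace AlgLaw

variable {n : ℕ}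

theorem ext_single {μ ν : AlgLaw n}
    (h : ∀ i j, μ (Pi.single i 1) (Pi.single j 1) = ν (Pi.single i 1) (Pi.single j 1)) : μ = ν :=
  coords_injective <| funext fun p => congrFun (h p.1 p.2.1) p.2.2

theorem ofTable_single (c : ℕ → ℕ → (Fin n → ℂ)) (i j : Fin n) :
    ofTable n c (Pi.single i 1) (Pi.single j 1) = c i j := by
  have h : ∀ i, Pi.single i (1 : ℂ) = Pi.basisFun ℂ (Fin n) i := fun i => by simp
  rw [h, h, ofTable, Module.Basis.constr_basis, Module.Basis.constr_basis]

theorem stdVec_eq_single (k : Fin n) : stdVec n k = Pi.single k 1 := by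
  funext m
  simp [stdVec, Pi.single_apply, Fin.ext_iff]

/-- The multiplication `x y = φ(x) y + ψ(y) x`. -/
def pairLaw (φ ψ : Module.Dual ℂ (Fin n → ℂ)) : AlgLaw n :=
  LinearMap.mk₂ ℂ (fun x y => φ x • y + ψ y • x)
    (by intros; simp only [map_add]; module) (by intros; simp only [map_smul, smul_eq_mul]; module)
    (by intros; simp only [map_add]; module) (by intros; simp only [map_smul, smul_eq_mul]; module)

@[simp] theorem pairLaw_apply (φ ψ : Module.Dual ℂ (Fin n → ℂ)) (x y : Fin n → ℂ) :
    pairLaw φ ψ x y = φ x • y + ψ y • x := rfl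

theorem act_pairLaw (g : (Fin n → ℂ) ≃ₗ[ℂ] (Fin n → ℂ)) (φ ψ : Module.Dual ℂ (Fin n → ℂ)) :
    act g (pairLaw φ ψ) = pairLaw (φ.comp (g.symm : (Fin n → ℂ) →ₗ[ℂ] (Fin n → ℂ)))
      (ψ.comp (g.symm : (Fin n → ℂ) →ₗ[ℂ] (Fin n → ℂ))) :=
  LinearMap.ext₂ fun x y => by simp

/-- The multiplications `x y = a χ(x) y + b χ(y) x`, for fixed `a` and `b`. -/
def lineLaw (a b : ℂ) : Module.Dual ℂ (Fin n → ℂ) →ₗ[ℂ] AlgLaw n where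
  toFun χ := pairLaw (a • χ) (b • χ)
  map_add' χ χ' := LinearMap.ext₂ fun x y => by simp; module
  map_smul' c χ := LinearMap.ext₂ fun x y => by simp; module

theorem lineLaw_apply (a b : ℂ) (χ : Module.Dual ℂ (Fin n → ℂ)) (x y : Fin n → ℂ) :
    lineLaw a b χ x y = (a * χ x) • y + (b * χ y) • x := rfl

theorem act_lineLaw (g : (Fin n → ℂ) ≃ₗ[ℂ] (Fin n → ℂ)) (a b : ℂ)
    (χ : Module.Dual ℂ (Fin n → ℂ)) :
    act g (lineLaw a b χ) = lineLaw a b (χ.comp (g.symm : (Fin n → ℂ) →ₗ[ℂ] (Fin n → ℂ))) :=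
  act_pairLaw g _ _

theorem lineLaw_mem_orbit (a b : ℂ) {χ χ' : Module.Dual ℂ (Fin n → ℂ)} (h : χ ≠ 0) (h' : χ' ≠ 0) :
    lineLaw a b χ' ∈ orbit (lineLaw a b χ) := by
  obtain ⟨g, hg⟩ := Module.Dual.exists_linearEquiv_comp_eq h h'
  refine ⟨g.symm, ?_⟩
  rw [act_lineLaw]
  congr 1
  exact LinearMap.ext fun v => (hg v).symm

/-- The range of `lineLaw a b` is a linear subspace, hence closed, and it contains the orbit.
Nonzero functionals form a single `GL_n`-orbit, so only `0` is added. -/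
theorem zariskiClosure_orbit_lineLaw (a b : ℂ) {χ : Module.Dual ℂ (Fin n → ℂ)} (h : χ ≠ 0) :
    zariskiClosure (orbit (lineLaw a b χ)) = orbit (lineLaw a b χ) ∪ {0} := by
  refine Set.Subset.antisymm ?_ (Set.union_subset (subset_zariskiClosure _)
    (Set.singleton_subset_iff.2 (degenerates_iff.1 (degenerates_zero _))))
  refine (zariskiClosure_subset_submodule (LinearMap.range (lineLaw a b)) ?_).trans ?_
  · rintro _ ⟨g, rfl⟩
    exact ⟨_, (act_lineLaw g a b χ).symm⟩
  · rintro _ ⟨χ', rfl⟩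
    by_cases h' : χ' = 0
    · right
      simp [h']
    · exact Or.inl (lineLaw_mem_orbit a b h h')

/-- The maps `A t` fix `x` and scale `ker φ` by `t`. They preserve `φ` and, since `ψ x = 0`,
multiply `ψ` by `t`. -/
theorem pairLaw_degenerates_left {φ ψ : Module.Dual ℂ (Fin n → ℂ)} {x : Fin n → ℂ}
    (hφ : φ x = 1) (hψ : ψ x = 0) : Degenerates (pairLaw φ ψ) (pairLaw φ 0) := by
  refine Degenerates.of_tendsto (fun t => pairLaw φ (t • ψ)) (fun t ht => ?_) fun p => ?_
  · let A : ℂ → (Fin n → ℂ) →ₗ[ℂ] (Fin n → ℂ) :=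
      fun t => t • LinearMap.id + (1 - t) • φ.smulRight x
    have hA : ∀ t v, A t v = t • v + ((1 - t) * φ v) • x := fun t v => by simp [A, smul_smul]
    have hinv : ∀ s t : ℂ, s * t = 1 → A s ∘ₗ A t = LinearMap.id := fun s t hst => by
      refine LinearMap.ext fun v => ?_
      have h2 : s * ((1 - t) * φ v) + (1 - s) * (t * φ v + (1 - t) * φ v) = 0 := by
        linear_combination -φ v * hst
      simp only [LinearMap.comp_apply, hA, map_add, map_smul, hφ, smul_eq_mul, smul_add, smul_smul,
        LinearMap.id_apply, hst, mul_one, one_smul]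
      rw [add_assoc, ← add_smul, h2, zero_smul, add_zero]
    let g : (Fin n → ℂ) ≃ₗ[ℂ] (Fin n → ℂ) := LinearEquiv.ofLinearMap (A t⁻¹) (A t) (hinv _ _ (inv_mul_cancel₀ ht))
      (hinv _ _ (mul_inv_cancel₀ ht))
    refine ⟨g, ?_⟩
    rw [act_pairLaw]
    congr 1
    · refine LinearMap.ext fun v => ?_
      change φ v = φ (A t v)
      simp only [hA, map_add, map_smul, hφ, smul_eq_mul]
      ring
    · refine LinearMap.ext fun v => ?_
      change t • ψ v = ψ (A t v)
      simp [hA, hψ]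
  · have : Continuous fun t : ℂ => coords (pairLaw φ (t • ψ)) p := by
      simp only [coords, pairLaw_apply, LinearMap.smul_apply, Pi.add_apply, Pi.smul_apply,
        smul_eq_mul]
      fun_prop
    simpa [coords] using (this.tendsto 0).mono_left nhdsWithin_le_nhds

/-- A limit along a diagonal one-parameter subgroup. -/
theorem degenerates_of_weights (w : Fin n → ℕ) {μ ν : AlgLaw n}
    (h : ∀ i j k, (w k = w i + w j ∧ coords μ (i, j, k) = coords ν (i, j, k)) ∨
      (w k < w i + w j ∧ coords ν (i, j, k) = 0) ∨
      (coords μ (i, j, k) = 0 ∧ coords ν (i, j, k) = 0)) : Degenerates μ ν := by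
  classical
  let g : ∀ t : ℂ, t ≠ 0 → (Fin n → ℂ) ≃ₗ[ℂ] (Fin n → ℂ) := fun t ht =>
    LinearEquiv.piCongrRight fun i => LinearEquiv.smulOfNeZero ℂ ℂ (t ^ w i)⁻¹ (by positivity)
  have hg : ∀ t ht v k, g t ht v k = (t ^ w k)⁻¹ * v k := fun t ht v k => rfl
  have hg' : ∀ t ht i, (g t ht).symm (Pi.single i 1) = t ^ w i • Pi.single i 1 := fun t ht i => by
    rw [LinearEquiv.symm_apply_eq]
    funext k
    by_cases hk : k = i
    · subst hk; simp [hg, ht]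
    · simp [hg, hk]
  -- The torus element multiplies the `(i, j, k)` structure constant by `t ^ (w i + w j - w k)`.
  have hc : ∀ t ht i j k, coords (act (g t ht) μ) (i, j, k) =
      (t ^ w k)⁻¹ * (t ^ w i * t ^ w j * coords μ (i, j, k)) := fun t ht i j k => by
    simp only [coords, act_apply, hg, hg', map_smul, LinearMap.smul_apply, Pi.smul_apply, smul_eq_mul]
    ring
  refine Degenerates.of_tendsto (fun t => if ht : t ≠ 0 then act (g t ht) μ else 0)
    (fun t ht => by simp only [ht, ne_eq, not_false_eq_true, dite_true]; exact ⟨_, rfl⟩) ?_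
  rintro ⟨i, j, k⟩
  -- The truncated subtraction is harmless: the limit is used only when `w k < w i + w j`.
  have hlim : Tendsto (fun t : ℂ => t ^ (w i + w j - w k) * coords μ (i, j, k)) (𝓝[≠] 0)
      (𝓝 (0 ^ (w i + w j - w k) * coords μ (i, j, k))) :=
    (Continuous.tendsto (by fun_prop) 0).mono_left nhdsWithin_le_nhds
  rcases h i j k with ⟨hw, hμ⟩ | ⟨hw, hν⟩ | ⟨hμ, hν⟩
  · refine tendsto_const_nhds.congr' ?_
    filter_upwards [self_mem_nhdsWithin] with t (ht : t ≠ 0)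
    simp only [ht, ne_eq, not_false_eq_true, dite_true, hc, hw, ← hμ, pow_add]
    field_simp
  · rw [hν]
    rw [zero_pow (by omega), zero_mul] at hlim
    refine hlim.congr' ?_
    filter_upwards [self_mem_nhdsWithin] with t (ht : t ≠ 0)
    simp only [ht, ne_eq, not_false_eq_true, dite_true, hc]
    rw [← mul_assoc, ← pow_add]
    congr 1
    rw [eq_inv_mul_iff_mul_eq₀ (by positivity), ← pow_add]
    congr 1
    omega
  · rw [hν]
    refine tendsto_const_nhds.congr' ?_
    filter_upwards [self_mem_nhdsWithin] with t (ht : t ≠ 0)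
    simp only [ht, ne_eq, not_false_eq_true, dite_true, hc, hμ, mul_zero]

/-! ### The listed algebras in coordinates -/

theorem pMinus_eq (hn : 0 < n) : pMinus n = lineLaw 1 (-1) (LinearMap.proj ⟨0, hn⟩) := by
  refine ext_single fun i j => ?_
  rw [pMinus, ofTable_single, lineLaw_apply, stdVec_eq_single, stdVec_eq_single]
  by_cases hi : i = ⟨0, hn⟩ <;> by_cases hj : j = ⟨0, hn⟩
  · subst hi hj
    simp
  all_goals simp_all [Fin.ext_iff, Pi.single_apply, Nat.one_le_iff_ne_zero, eq_comm]

theorem nu_eq (hn : 0 < n) (α : ℂ) :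
    nu n α = lineLaw α (1 - α) (LinearMap.proj ⟨0, hn⟩) := by
  refine ext_single fun i j => ?_
  have h0 : stdVec n 0 = Pi.single ⟨0, hn⟩ 1 := stdVec_eq_single ⟨0, hn⟩
  rw [nu, ofTable_single, lineLaw_apply, stdVec_eq_single, stdVec_eq_single, h0]
  by_cases hi : i = ⟨0, hn⟩ <;> by_cases hj : j = ⟨0, hn⟩
  · subst hi hj
    simp [← add_smul]
  all_goals simp_all [Fin.ext_iff, Pi.single_apply, Nat.one_le_iff_ne_zero, eq_comm]

theorem lambda2Sum_single (hn : 1 < n) (i j : Fin n) :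
    lambda2Sum n (Pi.single i 1) (Pi.single j 1) =
      if i.val = 0 ∧ j.val = 0 then Pi.single ⟨1, hn⟩ 1 else 0 := by
  rw [lambda2Sum, ofTable_single, ← stdVec_eq_single]

theorem n3MinusSum_single (hn : 2 < n) (i j : Fin n) :
    n3MinusSum n (Pi.single i 1) (Pi.single j 1) =
      if i.val = 0 ∧ j.val = 1 then Pi.single ⟨2, hn⟩ 1
      else if i.val = 1 ∧ j.val = 0 then -Pi.single ⟨2, hn⟩ 1 else 0 := by
  rw [n3MinusSum, ofTable_single, ← stdVec_eq_single]

theorem proj_ne_zero (i : Fin n) : (LinearMap.proj i : Module.Dual ℂ (Fin n → ℂ)) ≠ 0 := fun h => by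
  simpa using LinearMap.congr_fun h (Pi.single i 1)

theorem act_mem_orbit_self (g : (Fin n → ℂ) ≃ₗ[ℂ] (Fin n → ℂ)) (μ : AlgLaw n) :
    act g μ ∈ orbit μ := ⟨g, rfl⟩

theorem Degenerates.of_act {g : (Fin n → ℂ) ≃ₗ[ℂ] (Fin n → ℂ)} {μ ν : AlgLaw n}
    (h : Degenerates (act g μ) ν) : Degenerates μ ν :=
  (isomorphic_iff_mem_orbit.2 (act_mem_orbit_self g μ)).degenerates.trans h

/-! ### Every nonzero algebra degenerates to a listed one -/

/-- An algebra with an element `x` such that `x` and `x x` are linearly independent degenerates to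
`λ₂ ⊕ a_{n-2}`. -/
theorem degenerates_lambda2Sum (hn : 1 < n) {μ : AlgLaw n} {x : Fin n → ℂ}
    (h : ∀ c : ℂ, μ x x ≠ c • x) : Degenerates μ (lambda2Sum n) := by
  have hn0 : 0 < n := by omega
  have hx : x ≠ 0 := by
    rintro rfl
    exact h 0 (by simp)
  have hli : LinearIndependent ℂ ![x, μ x x] :=
    (LinearIndependent.pair_iff' hx).2 fun c hc => h c hc.symm
  have hli' : LinearIndependent ℂ fun i : Fin 2 => (Pi.single (Fin.castLE hn i) 1 : Fin n → ℂ) := by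
    have := (Pi.basisFun ℂ (Fin n)).linearIndependent.comp _ (Fin.castLE_injective hn)
    simpa [Function.comp_def] using this
  obtain ⟨g, hg⟩ := hli.exists_linearEquiv_apply_eq hli'
  have h0 : g x = Pi.single ⟨0, hn0⟩ 1 := hg 0
  have h1 : g (μ x x) = Pi.single ⟨1, hn⟩ 1 := hg 1
  refine Degenerates.of_act (g := g) ?_
  have key : act g μ (Pi.single ⟨0, hn0⟩ 1) (Pi.single ⟨0, hn0⟩ 1) =
      Pi.single ⟨1, hn⟩ 1 := by
    rw [act_apply, ← h0, LinearEquiv.symm_apply_apply, h1]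
  -- Any product other than `e₁ e₁` has total weight at least `3`, above every weight, so it dies in
  -- the limit.
  refine degenerates_of_weights (fun i => if i.val = 0 then 1 else 2) fun i j k => ?_
  simp only [coords, lambda2Sum_single hn]
  by_cases hij : i.val = 0 ∧ j.val = 0
  · obtain rfl : i = ⟨0, hn0⟩ := Fin.ext hij.1
    obtain rfl : j = ⟨0, hn0⟩ := Fin.ext hij.2
    rw [key]
    by_cases hk : k = ⟨1, hn⟩
    · simp [hk]
    · simp [hk]
  · refine Or.inr (Or.inl ⟨?_, by simp [hij]⟩)
    split_ifs <;> omega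

/-- An algebra in which every `x x` is a multiple of `x`, but some `x y` is not in the span of `x`
and `y`, degenerates to `n₃⁻ ⊕ a_{n-3}`. -/
theorem degenerates_n3MinusSum (hn : 2 < n) {μ : AlgLaw n} (hsq : ∀ x, ∃ c : ℂ, μ x x = c • x)
    {x y : Fin n → ℂ} (h : ∀ p q : ℂ, μ x y ≠ p • x + q • y) :
    Degenerates μ (n3MinusSum n) := by
  have hn0 : 0 < n := by omega
  have hn1 : 1 < n := by omega
  obtain ⟨cx, hcx⟩ := hsq x
  obtain ⟨cy, hcy⟩ := hsq y
  obtain ⟨c, hc⟩ := hsq (x + y)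
  -- Polarization: expand the square of `x + y`.
  have hyx : μ y x = -μ x y + (c - cx) • x + (c - cy) • y := by
    simp only [map_add, LinearMap.add_apply, hcx, hcy] at hc
    linear_combination (norm := module) hc
  have hli : LinearIndependent ℂ ![x, y, μ x y] := by
    rw [Fintype.linearIndependent_iff]
    intro a ha
    simp only [Fin.sum_univ_three, Matrix.cons_val] at ha
    have h2 : a 2 = 0 := by
      by_contra h2
      refine h (-(a 2)⁻¹ * a 0) (-(a 2)⁻¹ * a 1) ?_
      have : (a 2)⁻¹ • (a 0 • x + a 1 • y + a 2 • μ x y) = 0 := by rw [ha, smul_zero]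
      simp only [smul_add, smul_smul, inv_mul_cancel₀ h2, one_smul] at this
      linear_combination (norm := module) this
    have h1 : a 1 = 0 := by
      by_contra h1
      have : y = (-(a 1)⁻¹ * a 0) • x := by
        have : (a 1)⁻¹ • (a 0 • x + a 1 • y + a 2 • μ x y) = 0 := by rw [ha, smul_zero]
        simp only [smul_add, smul_smul, inv_mul_cancel₀ h1, one_smul, h2, zero_smul, add_zero] at this
        linear_combination (norm := module) this
      refine h ((-(a 1)⁻¹ * a 0) * cx) 0 ?_
      rw [this, map_smul, hcx, smul_smul, zero_smul, add_zero]
    have h0 : a 0 = 0 := by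
      by_contra h0
      have : x = 0 := by simpa [h1, h2, h0] using ha
      exact h 0 0 (by simp [this])
    intro i
    fin_cases i <;> assumption
  have hli' : LinearIndependent ℂ fun i : Fin 3 => (Pi.single (Fin.castLE hn i) 1 : Fin n → ℂ) := by
    have := (Pi.basisFun ℂ (Fin n)).linearIndependent.comp _ (Fin.castLE_injective hn)
    simpa [Function.comp_def] using this
  obtain ⟨g, hg⟩ := hli.exists_linearEquiv_apply_eq hli'
  have h0 : g x = Pi.single ⟨0, hn0⟩ 1 := hg 0
  have h1 : g y = Pi.single ⟨1, hn1⟩ 1 := hg 1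
  have h2 : g (μ x y) = Pi.single ⟨2, hn⟩ 1 := hg 2
  refine Degenerates.of_act (g := g) ?_
  have k00 : act g μ (Pi.single ⟨0, hn0⟩ 1) (Pi.single ⟨0, hn0⟩ 1) =
      cx • Pi.single ⟨0, hn0⟩ 1 := by
    rw [act_apply, ← h0, LinearEquiv.symm_apply_apply, hcx, map_smul]
  have k11 : act g μ (Pi.single ⟨1, hn1⟩ 1) (Pi.single ⟨1, hn1⟩ 1) =
      cy • Pi.single ⟨1, hn1⟩ 1 := by
    rw [act_apply, ← h1, LinearEquiv.symm_apply_apply, hcy, map_smul]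
  have k01 : act g μ (Pi.single ⟨0, hn0⟩ 1) (Pi.single ⟨1, hn1⟩ 1) =
      Pi.single ⟨2, hn⟩ 1 := by
    rw [act_apply, ← h0, ← h1, LinearEquiv.symm_apply_apply, LinearEquiv.symm_apply_apply, h2]
  have k10 : act g μ (Pi.single ⟨1, hn1⟩ 1) (Pi.single ⟨0, hn0⟩ 1) =
      -Pi.single ⟨2, hn⟩ 1 + (c - cx) • Pi.single ⟨0, hn0⟩ 1 +
        (c - cy) • Pi.single ⟨1, hn1⟩ 1 := by
    rw [act_apply, ← h0, ← h1, LinearEquiv.symm_apply_apply, LinearEquiv.symm_apply_apply, hyx]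
    simp only [map_add, map_neg, map_smul, h0, h1, h2]
  -- Among products of `e₁` and `e₂`, components along `e₁`, `e₂` have weight `1 < 2` and vanish;
  -- only `± e₃` survives.
  refine degenerates_of_weights (fun i => if i.val ≤ 1 then 1 else 2) fun i j k => ?_
  simp only [coords, n3MinusSum_single hn]
  by_cases hij : i.val ≤ 1 ∧ j.val ≤ 1
  · have hi : i = ⟨0, hn0⟩ ∨ i = ⟨1, hn1⟩ := by simp only [Fin.ext_iff]; omega
    have hj : j = ⟨0, hn0⟩ ∨ j = ⟨1, hn1⟩ := by simp only [Fin.ext_iff]; omega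
    rcases hi with rfl | rfl <;> rcases hj with rfl | rfl
    · rw [k00]
      by_cases hk : k = ⟨0, hn0⟩
      · simp [hk]
      · simp [hk]
    · rw [k01]
      by_cases hk : k = ⟨2, hn⟩
      · simp [hk]
      · simp [hk]
    · rw [k10]
      by_cases hk : k.val ≤ 1
      · have : k ≠ ⟨2, hn⟩ := by rintro rfl; simp at hk
        simp [hk, this]
      · have hk0 : k ≠ ⟨0, hn0⟩ := by rintro rfl; simp at hk
        have hk1 : k ≠ ⟨1, hn1⟩ := by rintro rfl; simp at hk
        by_cases hk : k = ⟨2, hn⟩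
        · simp [hk]
        · simp [hk, hk0, hk1]
    · rw [k11]
      by_cases hk : k = ⟨1, hn1⟩
      · simp [hk]
      · simp [hk]
  · refine Or.inr (Or.inl ⟨by split_ifs <;> omega, ?_⟩)
    rw [if_neg (by omega), if_neg (by omega)]
    rfl

/-- A multiplication for which every product `x y` lies in the span of `x` and `y` has the form
`x y = φ(x) y + ψ(y) x`. -/
theorem exists_eq_pairLaw (hn : 2 < n) {μ : AlgLaw n}
    (h : ∀ x y, ∃ p q : ℂ, μ x y = p • x + q • y) : ∃ φ ψ, μ = pairLaw φ ψ := by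
  let e : Fin n → Fin n → ℂ := fun i => Pi.single i 1
  let c : Fin n → Fin n → Fin n → ℂ := fun i j k => μ (e i) (e j) k
  have hself : ∀ i, e i i = 1 := fun i => by simp [e]
  have hne : ∀ {i k}, k ≠ i → e i k = 0 := fun {i k} hk => by simp [e, hk]
  have hvan : ∀ {i j k}, k ≠ i → k ≠ j → c i j k = 0 := fun {i j k} hi hj => by
    obtain ⟨p, q, hpq⟩ := h (e i) (e j)
    simp [c, hpq, hne hi, hne hj]
  -- In `e_i (e_j + e_k)` the coefficients of `e_j` and `e_k` are both `q`.
  have hright : ∀ {i j k}, i ≠ j → i ≠ k → j ≠ k → c i j j = c i k k := fun {i j k} hij hik hjk => by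
    obtain ⟨p, q, hpq⟩ := h (e i) (e j + e k)
    have hj := congrFun hpq j
    have hk := congrFun hpq k
    simp only [map_add, Pi.add_apply, Pi.smul_apply, smul_eq_mul, hself, hne hjk, hne hjk.symm,
      hne hij.symm, hne hik.symm] at hj hk
    have h1 : μ (e i) (e k) j = 0 := hvan hij.symm hjk
    have h2 : μ (e i) (e j) k = 0 := hvan hik.symm hjk.symm
    simp only [c]
    linear_combination hj - hk - h1 + h2
  have hleft : ∀ {i j k}, i ≠ j → i ≠ k → j ≠ k → c j i j = c k i k := fun {i j k} hij hik hjk => by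
    obtain ⟨p, q, hpq⟩ := h (e j + e k) (e i)
    have hj := congrFun hpq j
    have hk := congrFun hpq k
    simp only [map_add, Pi.add_apply, Pi.smul_apply, smul_eq_mul, hself, hne hjk, hne hjk.symm,
      hne hij.symm, hne hik.symm, LinearMap.add_apply] at hj hk
    have h1 : μ (e k) (e i) j = 0 := hvan hjk hij.symm
    have h2 : μ (e j) (e i) k = 0 := hvan hjk.symm hik.symm
    simp only [c]
    linear_combination hj - hk - h1 + h2
  -- In `p (e_i + e_j) + q (e_i + e_k)` the coefficient of `e_i` is the sum of those of `e_j` and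
  -- `e_k`. This determines `e_i e_i`.
  have hdiag : ∀ {i j k}, i ≠ j → i ≠ k → j ≠ k →
      c i i i + c i k i + c j i i = c j i j + c j k j + c i k k + c j k k :=
    fun {i j k} hij hik hjk => by
    obtain ⟨p, q, hpq⟩ := h (e i + e j) (e i + e k)
    have hi := congrFun hpq i
    have hj := congrFun hpq j
    have hk := congrFun hpq k
    simp only [map_add, Pi.add_apply, Pi.smul_apply, smul_eq_mul, hself, hne hjk, hne hjk.symm,
      hne hij.symm, hne hik.symm, hne hij, hne hik, LinearMap.add_apply] at hi hj hk
    have h1 : μ (e j) (e k) i = 0 := hvan hij hik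
    have h2 : μ (e i) (e i) j = 0 := hvan hij.symm hij.symm
    have h3 : μ (e i) (e k) j = 0 := hvan hij.symm hjk
    have h4 : μ (e i) (e i) k = 0 := hvan hik.symm hik.symm
    have h5 : μ (e j) (e i) k = 0 := hvan hjk.symm hik.symm
    simp only [c]
    linear_combination hi - hj - hk - h1 + h2 + h3 + h4 + h5
  -- Here `n ≥ 3` enters: two indices never exhaust `Fin n`.
  have hex : ∀ i j : Fin n, ∃ k, i ≠ k ∧ j ≠ k := fun i j => by
    obtain ⟨k, hk⟩ : ∃ k, k ∉ ({i, j} : Finset (Fin n)) := by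
      by_contra! hall
      have h1 := Finset.card_le_card (fun k _ => hall k : (Finset.univ : Finset (Fin n)) ⊆ {i, j})
      rw [Finset.card_univ, Fintype.card_fin] at h1
      have h2 := Finset.card_le_two (a := i) (b := j)
      omega
    simp only [Finset.mem_insert, Finset.mem_singleton, not_or] at hk
    exact ⟨k, Ne.symm hk.1, Ne.symm hk.2⟩
  choose o ho using fun i => hex i i
  have ha : ∀ {i j}, i ≠ j → c i j j = c i (o i) (o i) := fun {i j} hij => by
    by_cases hj : j = o i
    · rw [← hj]
    · exact hright hij (ho i).1 hj
  have hb : ∀ {i j}, i ≠ j → c j i j = c (o i) i (o i) := fun {i j} hij => by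
    by_cases hj : j = o i
    · rw [← hj]
    · exact hleft hij (ho i).1 hj
  let φ := (Pi.basisFun ℂ (Fin n)).constr ℂ fun i => c i (o i) (o i)
  let ψ := (Pi.basisFun ℂ (Fin n)).constr ℂ fun i => c (o i) i (o i)
  have hφ : ∀ i, φ (e i) = c i (o i) (o i) := fun i => by
    simp only [φ, e, ← Pi.basisFun_apply, Module.Basis.constr_basis]
  have hψ : ∀ i, ψ (e i) = c (o i) i (o i) := fun i => by
    simp only [ψ, e, ← Pi.basisFun_apply, Module.Basis.constr_basis]
  refine ⟨φ, ψ, ext_single fun i j => funext fun k => ?_⟩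
  change c i j k = φ (e i) * e j k + ψ (e j) * e i k
  rw [hφ, hψ]
  by_cases hij : i = j
  · subst hij
    by_cases hk : k = i
    · subst hk
      obtain ⟨l, hl, hl'⟩ := hex k (o k)
      have := hdiag (ho k).1 hl hl'
      -- After the terms at `l` and `o k` cancel, what remains is `c k k k = φ(e_k) + ψ(e_k)`.
      rw [ha hl, hb hl.symm, ← hb hl'.symm, ha (ho k).1.symm, ha hl'] at this
      rw [hself]
      linear_combination this
    · rw [hvan hk hk, hne hk]; ring
  · by_cases hk : k = i
    · subst hk
      rw [hself, hne hij, hb (Ne.symm hij)]; ring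
    · by_cases hk' : k = j
      · subst hk'
        rw [hself, hne hk, ha hij]; ring
      · rw [hvan hk hk', hne hk, hne hk']; ring

/-- If `ψ` vanishes somewhere that `φ` does not, `ψ` can be contracted away, leaving `ν_n(1)`.
Otherwise `ker ψ ⊆ ker φ`, so `φ = c ψ`: the value `c = -1` gives `p_n⁻`, and any other `c` is
normalized by absorbing `c + 1` into the functional. -/
theorem exists_degenerates_model_of_pairLaw (hn : 0 < n) {φ ψ : Module.Dual ℂ (Fin n → ℂ)}
    (h : pairLaw φ ψ ≠ 0) : ∃ k, Degenerates (pairLaw φ ψ) (model n k) := by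
  have hline : ∀ a b {χ : Module.Dual ℂ (Fin n → ℂ)}, χ ≠ 0 →
      Degenerates (lineLaw a b χ) (lineLaw a b (LinearMap.proj ⟨0, hn⟩)) := fun a b χ hχ =>
    (isomorphic_iff_mem_orbit.2 (lineLaw_mem_orbit a b hχ (proj_ne_zero _))).degenerates
  by_cases hker : ∃ x, φ x ≠ 0 ∧ ψ x = 0
  · obtain ⟨x, hx, hψ⟩ := hker
    refine ⟨Kind.nu 1, ?_⟩
    have h1 : Degenerates (pairLaw φ ψ) (pairLaw φ 0) :=
      pairLaw_degenerates_left (x := (φ x)⁻¹ • x) (by simp [hx]) (by simp [hψ])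
    have h2 : pairLaw φ 0 = lineLaw 1 (1 - 1) φ :=
      LinearMap.ext₂ fun x y => by simp [lineLaw_apply]
    rw [h2] at h1
    refine h1.trans ?_
    rw [model, nu_eq hn]
    exact hline _ _ (by rintro rfl; simp at hx)
  · push Not at hker
    have hψ : ψ ≠ 0 := by
      rintro rfl
      have : φ = 0 := LinearMap.ext fun x => by
        by_contra hx
        exact hker x hx rfl
      exact h (LinearMap.ext₂ fun x y => by simp [this])
    obtain ⟨y, hy⟩ : ∃ y, ψ y ≠ 0 := by
      by_contra! h0
      exact hψ (LinearMap.ext h0)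
    obtain ⟨c, rfl⟩ : ∃ c : ℂ, φ = c • ψ := by
      refine ⟨φ y / ψ y, LinearMap.ext fun v => ?_⟩
      by_contra hv
      refine hker (v - (ψ v / ψ y) • y) (fun h0 => hv ?_) (by simp [hy])
      simp only [map_sub, map_smul, smul_eq_mul, sub_eq_zero] at h0
      rw [h0, LinearMap.smul_apply, smul_eq_mul]
      field_simp
    by_cases hc : c + 1 = 0
    · refine ⟨Kind.p, ?_⟩
      have h1 : pairLaw (c • ψ) ψ = lineLaw 1 (-1) (-ψ) := LinearMap.ext₂ fun x y => by
        simp [lineLaw_apply, eq_neg_of_add_eq_zero_left hc, add_comm]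
      rw [h1, model, pMinus_eq hn]
      exact hline _ _ (neg_ne_zero.2 hψ)
    · refine ⟨Kind.nu (c / (c + 1)), ?_⟩
      have h1 : pairLaw (c • ψ) ψ = lineLaw (c / (c + 1)) (1 - c / (c + 1)) ((c + 1) • ψ) :=
        LinearMap.ext₂ fun x y => by
          simp only [pairLaw_apply, lineLaw_apply, LinearMap.smul_apply, smul_eq_mul]
          congr 2 <;> field_simp
          ring
      rw [h1, model, nu_eq hn]
      exact hline _ _ (smul_ne_zero hc hψ)

/-- Every algebra that is not abelian degenerates to a member of the list. -/
theorem exists_degenerates_model (hn : 2 < n) {μ : AlgLaw n} (hμ : μ ≠ 0) :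
    ∃ k, Degenerates μ (model n k) := by
  by_cases hsq : ∀ x, ∃ c : ℂ, μ x x = c • x
  · by_cases hspan : ∀ x y, ∃ p q : ℂ, μ x y = p • x + q • y
    · obtain ⟨φ, ψ, rfl⟩ := exists_eq_pairLaw hn hspan
      exact exists_degenerates_model_of_pairLaw (by omega) hμ
    · push Not at hspan
      obtain ⟨x, y, h⟩ := hspan
      exact ⟨Kind.n3, degenerates_n3MinusSum hn hsq h⟩
  · push Not at hsq
    obtain ⟨x, h⟩ := hsq
    exact ⟨Kind.lam2, degenerates_lambda2Sum (by omega) h⟩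

/-! ### Invariant subspaces separating the listed algebras -/

/-- Membership in a `GL_n`-stable linear subspace is preserved by degenerations. -/
theorem Degenerates.mem_submodule {μ ν : AlgLaw n} (h : Degenerates μ ν)
    (W : Submodule ℂ (AlgLaw n)) (hW : ∀ g, ∀ ρ ∈ W, act g ρ ∈ W) (hμ : μ ∈ W) : ν ∈ W := by
  refine zariskiClosure_subset_submodule W ?_ (degenerates_iff.1 h)
  rintro _ ⟨g, rfl⟩
  exact hW g μ hμ

theorem Degenerates.exists_eq_lineLaw {a b : ℂ} {χ : Module.Dual ℂ (Fin n → ℂ)} {ν : AlgLaw n}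
    (h : Degenerates (lineLaw a b χ) ν) : ∃ χ', lineLaw a b χ' = ν := by
  refine h.mem_submodule (LinearMap.range (lineLaw a b)) ?_ ⟨χ, rfl⟩
  rintro g _ ⟨χ', rfl⟩
  exact ⟨_, (act_lineLaw g a b χ').symm⟩

theorem lineLaw_ne_lambda2Sum (hn : 1 < n) (a b : ℂ) (χ : Module.Dual ℂ (Fin n → ℂ)) :
    lineLaw a b χ ≠ lambda2Sum n := fun h => by
  have := congrFun (LinearMap.congr_fun₂ h (Pi.single ⟨0, by omega⟩ 1)
    (Pi.single ⟨0, by omega⟩ 1)) ⟨1, hn⟩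
  simp [lineLaw_apply, lambda2Sum_single hn] at this

theorem lineLaw_ne_n3MinusSum (hn : 2 < n) (a b : ℂ) (χ : Module.Dual ℂ (Fin n → ℂ)) :
    lineLaw a b χ ≠ n3MinusSum n := fun h => by
  have := congrFun (LinearMap.congr_fun₂ h (Pi.single ⟨0, by omega⟩ 1)
    (Pi.single ⟨1, by omega⟩ 1)) ⟨2, hn⟩
  simp [lineLaw_apply, n3MinusSum_single hn] at this

/-- `a + b` and `a` are determined up to a common factor by `x y = a χ(x) y + b χ(y) x`. -/
theorem lineLaw_eq_proj (hn : 1 < n) {a b c d : ℂ} {χ : Module.Dual ℂ (Fin n → ℂ)}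
    (h : lineLaw a b χ = lineLaw c d (LinearMap.proj ⟨0, by omega⟩)) :
    ∃ z : ℂ, (a + b) * z = c + d ∧ a * z = c := by
  have h1 := congrFun (LinearMap.congr_fun₂ h (Pi.single ⟨0, by omega⟩ 1)
    (Pi.single ⟨0, by omega⟩ 1)) ⟨0, by omega⟩
  have h2 := congrFun (LinearMap.congr_fun₂ h (Pi.single ⟨0, by omega⟩ 1)
    (Pi.single ⟨1, hn⟩ 1)) ⟨1, hn⟩
  simp only [lineLaw_apply, LinearMap.proj_apply, Pi.add_apply, Pi.smul_apply, Pi.single_apply,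
    smul_eq_mul, Fin.mk.injEq, one_ne_zero, zero_ne_one, if_true, if_false, mul_one, mul_zero,
    add_zero] at h1 h2
  exact ⟨χ (Pi.single ⟨0, by omega⟩ 1), by linear_combination h1, h2⟩

/-- Multiplications all of whose left and right multiplication operators have trace zero. -/
def traceFree (n : ℕ) : Submodule ℂ (AlgLaw n) where
  carrier := {μ | ∀ x, LinearMap.trace ℂ _ (μ x) = 0 ∧ LinearMap.trace ℂ _ (μ.flip x) = 0}
  add_mem' {μ ν} hμ hν x := by
    have : (μ + ν).flip x = μ.flip x + ν.flip x := rfl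
    simp [this, hμ x, hν x]
  zero_mem' x := by
    have : (0 : AlgLaw n).flip x = 0 := rfl
    simp [this]
  smul_mem' c μ hμ x := by
    have : (c • μ).flip x = c • μ.flip x := rfl
    simp [this, hμ x]

theorem act_mem_traceFree (g : (Fin n → ℂ) ≃ₗ[ℂ] (Fin n → ℂ)) (μ : AlgLaw n)
    (h : μ ∈ traceFree n) : act g μ ∈ traceFree n := fun x => by
  have h1 : act g μ x = g.conj (μ (g.symm x)) := rfl
  have h2 : (act g μ).flip x = g.conj (μ.flip (g.symm x)) := rfl
  rw [h1, h2, LinearMap.trace_conj', LinearMap.trace_conj']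
  exact h _

theorem mem_traceFree_of_coords {μ : AlgLaw n} (h : ∀ i j, coords μ (i, j, j) = 0)
    (h' : ∀ i j, coords μ (j, i, j) = 0) : μ ∈ traceFree n := by
  have key : ∀ ν : AlgLaw n, (∀ i j, coords ν (i, j, j) = 0) →
      ∀ x, LinearMap.trace ℂ _ (ν x) = 0 := fun ν hν x => by
    have : LinearMap.trace ℂ (Fin n → ℂ) ∘ₗ ν = 0 := by
      refine LinearMap.pi_ext' fun i => LinearMap.ext_ring ?_
      simp only [LinearMap.comp_apply, LinearMap.zero_apply, LinearMap.coe_single]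
      rw [LinearMap.trace_eq_matrix_trace ℂ (Pi.basisFun ℂ (Fin n))]
      refine Finset.sum_eq_zero fun j _ => ?_
      have := hν i j
      rw [coords] at this
      simpa [LinearMap.toMatrix_apply] using this
    exact LinearMap.congr_fun this x
  exact fun x => ⟨key μ h x, key μ.flip h' x⟩

theorem trace_lineLaw (a b : ℂ) (χ : Module.Dual ℂ (Fin n → ℂ)) (x : Fin n → ℂ) :
    LinearMap.trace ℂ _ (lineLaw a b χ x) = (n * a + b) * χ x := by
  have : lineLaw a b χ x = (a * χ x) • LinearMap.id + b • χ.smulRight x :=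
    LinearMap.ext fun y => by simp [lineLaw_apply, smul_smul]
  rw [this]
  simp
  ring

/-- Left and right multiplication by `x` have traces `(n a + b) χ(x)` and `(n b + a) χ(x)`. The
linear system in `a`, `b` has determinant `n ^ 2 - 1 ≠ 0`. -/
theorem lineLaw_not_mem_traceFree (hn : 1 < n) {a b : ℂ} (hab : a ≠ 0 ∨ b ≠ 0)
    {χ : Module.Dual ℂ (Fin n → ℂ)} (hχ : χ ≠ 0) : lineLaw a b χ ∉ traceFree n := fun h => by
  obtain ⟨x, hx⟩ : ∃ x, χ x ≠ 0 := by
    by_contra! h0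
    exact hχ (LinearMap.ext h0)
  have hflip : (lineLaw a b χ).flip = lineLaw b a χ :=
    LinearMap.ext₂ fun x y => by simp [lineLaw_apply, add_comm]
  obtain ⟨h1, h2⟩ := h x
  rw [hflip] at h2
  rw [trace_lineLaw, mul_eq_zero, or_iff_left hx] at h1 h2
  have hn1 : (n : ℂ) ^ 2 - 1 ≠ 0 := by
    rw [sub_ne_zero]
    exact_mod_cast (Nat.one_lt_pow two_ne_zero hn).ne'
  rcases hab with ha | hb
  · exact mul_ne_zero hn1 ha (by linear_combination n * h1 - h2)
  · exact mul_ne_zero hn1 hb (by linear_combination n * h2 - h1)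

theorem lambda2Sum_mem_traceFree (hn : 1 < n) : lambda2Sum n ∈ traceFree n := by
  refine mem_traceFree_of_coords (fun i j => ?_) (fun i j => ?_) <;>
  · simp only [coords, lambda2Sum_single hn]
    split_ifs with h
    · have : j ≠ ⟨1, hn⟩ := fun hj => by simp [hj] at h
      simp [this]
    · rfl

theorem n3MinusSum_mem_traceFree (hn : 2 < n) : n3MinusSum n ∈ traceFree n := by
  refine mem_traceFree_of_coords (fun i j => ?_) (fun i j => ?_) <;>
  · simp only [coords, n3MinusSum_single hn]
    have : j.val ≤ 1 → j ≠ ⟨2, hn⟩ := fun h hj => by simp [hj] at h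
    split_ifs with h h
    · simp [this (by omega)]
    · simp [this (by omega)]
    · rfl

/-- `λ₂ ⊕ a_{n-2}` is commutative, hence so are its degenerations. -/
theorem not_degenerates_lambda2Sum_n3MinusSum (hn : 2 < n) :
    ¬ Degenerates (lambda2Sum n) (n3MinusSum n) := fun h => by
  have := h.mem_submodule
    { carrier := {μ | ∀ x y, μ x y = μ y x}
      add_mem' := fun {μ ν} hμ hν x y => by simp [hμ x y, hν x y]
      zero_mem' := fun x y => rfl
      smul_mem' := fun c μ hμ x y => by simp [hμ x y] }
    (fun g ρ hρ x y => by simp [hρ (g.symm x)]) (fun x y => by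
      refine LinearMap.congr_fun₂ (f := lambda2Sum n) (g := (lambda2Sum n).flip)
        (ext_single fun i j => ?_) x y
      rw [LinearMap.flip_apply, lambda2Sum_single (by omega), lambda2Sum_single (by omega)]
      simp only [and_comm])
  have := congrFun (this (Pi.single ⟨0, by omega⟩ 1) (Pi.single ⟨1, by omega⟩ 1)) ⟨2, hn⟩
  simp [n3MinusSum_single hn] at this
  norm_num [self_eq_neg] at this

/-- `n₃⁻ ⊕ a_{n-3}` is anticommutative, hence so are its degenerations. -/
theorem not_degenerates_n3MinusSum_lambda2Sum (hn : 2 < n) :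
    ¬ Degenerates (n3MinusSum n) (lambda2Sum n) := fun h => by
  have := h.mem_submodule
    { carrier := {μ | ∀ x y, μ x y = -μ y x}
      add_mem' := fun {μ ν} hμ hν x y => by simp [hμ x y, hν x y, add_comm]
      zero_mem' := fun x y => by simp
      smul_mem' := fun c μ hμ x y => by simp [hμ x y] }
    (fun g ρ hρ x y => by simp [hρ (g.symm x)]) (fun x y => by
      refine LinearMap.congr_fun₂ (f := n3MinusSum n) (g := -(n3MinusSum n).flip)
        (ext_single fun i j => ?_) x y
      rw [LinearMap.neg_apply, LinearMap.neg_apply, LinearMap.flip_apply, n3MinusSum_single hn,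
        n3MinusSum_single hn]
      split_ifs <;> first | omega | simp)
  have := congrFun (this (Pi.single ⟨0, by omega⟩ 1) (Pi.single ⟨0, by omega⟩ 1)) ⟨1, by omega⟩
  simp [lambda2Sum_single (show 1 < n by omega)] at this
  norm_num [self_eq_neg] at this

theorem not_degenerates_of_traceFree (hn : 1 < n) {μ : AlgLaw n} (hμ : μ ∈ traceFree n) {a b : ℂ}
    (hab : a ≠ 0 ∨ b ≠ 0) {χ : Module.Dual ℂ (Fin n → ℂ)} (hχ : χ ≠ 0) :
    ¬ Degenerates μ (lineLaw a b χ) := fun h =>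
  lineLaw_not_mem_traceFree hn hab hχ (h.mem_submodule _ act_mem_traceFree hμ)

theorem nu_weights_ne_zero (α : ℂ) : α ≠ 0 ∨ 1 - α ≠ 0 := by
  by_cases h : α = 0
  · right; simp [h]
  · exact Or.inl h

/-- No member of the list degenerates to a different one. -/
theorem not_degenerates_model (hn : 2 < n) {k l : Kind} (hkl : k ≠ l) :
    ¬ Degenerates (model n k) (model n l) := by
  have hn1 : 1 < n := by omega
  have hn0 : 0 < n := by omega
  intro h
  cases k with
  | p =>
    rw [model, pMinus_eq hn0] at h
    obtain ⟨χ, hχ⟩ := h.exists_eq_lineLaw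
    cases l with
    | p => exact hkl rfl
    | n3 => exact lineLaw_ne_n3MinusSum hn _ _ _ hχ
    | lam2 => exact lineLaw_ne_lambda2Sum hn1 _ _ _ hχ
    | nu β =>
      rw [model, nu_eq hn0] at hχ
      -- The coefficient sum is `0` for `p_n⁻` and `1` for `ν_n(β)`, so `h1` reads `0 = 1`.
      obtain ⟨z, h1, -⟩ := lineLaw_eq_proj hn1 hχ
      simp at h1
  | n3 =>
    have ht := n3MinusSum_mem_traceFree hn
    cases l with
    | p =>
      rw [model, model, pMinus_eq hn0] at h
      exact not_degenerates_of_traceFree hn1 ht (by simp) (proj_ne_zero _) h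
    | n3 => exact hkl rfl
    | lam2 => exact not_degenerates_n3MinusSum_lambda2Sum hn h
    | nu β =>
      rw [model, model, nu_eq hn0] at h
      exact not_degenerates_of_traceFree hn1 ht (nu_weights_ne_zero β) (proj_ne_zero _) h
  | lam2 =>
    have ht := lambda2Sum_mem_traceFree hn1
    cases l with
    | p =>
      rw [model, model, pMinus_eq hn0] at h
      exact not_degenerates_of_traceFree hn1 ht (by simp) (proj_ne_zero _) h
    | n3 => exact not_degenerates_lambda2Sum_n3MinusSum hn h
    | lam2 => exact hkl rfl
    | nu β =>
      rw [model, model, nu_eq hn0] at h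
      exact not_degenerates_of_traceFree hn1 ht (nu_weights_ne_zero β) (proj_ne_zero _) h
  | nu α =>
    rw [model, nu_eq hn0] at h
    obtain ⟨χ, hχ⟩ := h.exists_eq_lineLaw
    cases l with
    | p =>
      rw [model, pMinus_eq hn0] at hχ
      obtain ⟨z, h1, h2⟩ := lineLaw_eq_proj hn1 hχ
      have hz : z = 0 := by linear_combination h1
      simp [hz] at h2
    | n3 => exact lineLaw_ne_n3MinusSum hn _ _ _ hχ
    | lam2 => exact lineLaw_ne_lambda2Sum hn1 _ _ _ hχ
    | nu β =>
      rw [model, nu_eq hn0] at hχ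
      obtain ⟨z, h1, h2⟩ := lineLaw_eq_proj hn1 hχ
      have hz : z = 1 := by linear_combination h1
      exact hkl (by rw [← h2, hz, mul_one])

/-! ### Chains and levels -/

/-- Everything degenerates to `0`, so a zero member would contradict the antichain property. -/
theorem model_ne_zero (hn : 2 < n) (k : Kind) : model n k ≠ 0 := fun h => by
  obtain ⟨l, hl⟩ : ∃ l, k ≠ l := by
    by_cases hk : k = Kind.p
    · exact ⟨Kind.n3, by simp [hk]⟩
    · exact ⟨Kind.p, hk⟩
  refine not_degenerates_model hn hl.symm ?_
  rw [h]
  exact degenerates_zero _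

theorem eq_zero_of_isomorphic_zero {μ : AlgLaw n} (h : Isomorphic μ 0) : μ = 0 :=
  h.symm.degenerates.eq_zero

/-- The only proper degeneration of a member of the list is the abelian algebra. -/
theorem eq_zero_of_properlyDegenerates_model (hn : 2 < n) {μ ν : AlgLaw n} {k : Kind}
    (hμ : Isomorphic μ (model n k)) (h : ProperlyDegenerates μ ν) : ν = 0 := by
  by_contra hν
  obtain ⟨l, hl⟩ := exists_degenerates_model hn hν
  have hkl : k = l := by
    by_contra hkl
    exact not_degenerates_model hn hkl ((hμ.symm.degenerates.trans h.1).trans hl)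
  subst hkl
  -- `ν` degenerates back to `μ`, so antisymmetry contradicts properness.
  exact h.2 (h.1.isomorphic (hl.trans hμ.symm.degenerates))

theorem not_properlyDegenerates_zero (ν : AlgLaw n) : ¬ ProperlyDegenerates 0 ν := fun h => by
  obtain rfl := h.1.eq_zero
  exact h.2 (isomorphic_iff_mem_orbit.2 (mem_orbit_self 0))

theorem properlyDegenerates_zero {μ : AlgLaw n} (hμ : μ ≠ 0) : ProperlyDegenerates μ 0 :=
  ⟨degenerates_zero μ, fun h => hμ (eq_zero_of_isomorphic_zero h)⟩

theorem length_le_level (s : RelSeries {p : AlgLaw n × AlgLaw n | DirectlyDegenerates p.1 p.2}) :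
    (s.length : ℕ∞) ≤ level s.head :=
  le_iSup (fun s' : {s' : RelSeries {p : AlgLaw n × AlgLaw n | DirectlyDegenerates p.1 p.2} //
    s'.head = s.head} => (s'.1.length : ℕ∞)) ⟨s, rfl⟩

theorem one_le_level {μ ν : AlgLaw n} (h : DirectlyDegenerates μ ν) : 1 ≤ level μ :=
  length_le_level ((RelSeries.singleton _ ν).cons μ h)

theorem two_le_level {μ ν ρ : AlgLaw n} (h : DirectlyDegenerates μ ν)
    (h' : DirectlyDegenerates ν ρ) : 2 ≤ level μ := by
  let s : RelSeries {p : AlgLaw n × AlgLaw n | DirectlyDegenerates p.1 p.2} :=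
    (RelSeries.singleton _ ρ).cons ν h'
  exact length_le_level (s.cons μ h)

theorem level_zero : level (0 : AlgLaw n) = 0 := by
  refine le_antisymm (iSup_le ?_) bot_le
  rintro ⟨s, hs⟩
  by_contra hlen
  have hpos : 0 < s.length := by
    by_contra h0
    exact hlen (by simp [Nat.eq_zero_of_not_pos h0])
  have h1 : DirectlyDegenerates (s 0) _ := s.step ⟨0, hpos⟩
  rw [RelSeries.apply_zero, hs] at h1
  exact not_properlyDegenerates_zero _ h1.1

theorem level_eq_one_of_isomorphic (hn : 2 < n) {μ : AlgLaw n} {k : Kind}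
    (hμ : Isomorphic μ (model n k)) : level μ = 1 := by
  have hμ0 : μ ≠ 0 := by
    rintro rfl
    exact model_ne_zero hn k (eq_zero_of_isomorphic_zero hμ.symm)
  refine le_antisymm (iSup_le ?_) (one_le_level (ν := 0) ⟨properlyDegenerates_zero hμ0, ?_⟩)
  · rintro ⟨s, hs⟩
    by_contra hlen
    have hlt : 1 < s.length := by
      by_contra h0
      exact hlen (by exact_mod_cast not_lt.1 h0)
    have h1 : DirectlyDegenerates (s 0) (s (Fin.succ ⟨0, by omega⟩)) := s.step ⟨0, by omega⟩
    have h2 : DirectlyDegenerates (s (Fin.castSucc ⟨1, hlt⟩)) _ := s.step ⟨1, hlt⟩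
    have he : (Fin.castSucc ⟨1, hlt⟩ : Fin (s.length + 1)) = Fin.succ ⟨0, by omega⟩ := rfl
    rw [RelSeries.apply_zero, hs] at h1
    rw [he, eq_zero_of_properlyDegenerates_model hn hμ h1.1] at h2
    exact not_properlyDegenerates_zero _ h2.1
  · rintro ⟨ρ, h1, h2⟩
    rw [eq_zero_of_properlyDegenerates_model hn hμ h1] at h2
    exact not_properlyDegenerates_zero _ h2

/-- A nonzero algebra outside the list has a listed one strictly between itself and `0`. Its direct
degenerations are therefore nonzero and can be continued, giving level at least `2`. -/
theorem level_eq_one_iff (hn : 2 < n) {μ : AlgLaw n} :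
    level μ = 1 ↔ ∃ k, Isomorphic μ (model n k) := by
  refine ⟨fun h => ?_, fun ⟨k, hk⟩ => level_eq_one_of_isomorphic hn hk⟩
  have hμ0 : μ ≠ 0 := by
    rintro rfl
    simp [level_zero] at h
  obtain ⟨k, hk⟩ := exists_degenerates_model hn hμ0
  refine ⟨k, ?_⟩
  by_contra hiso
  obtain ⟨ν, hν⟩ := exists_directlyDegenerates (properlyDegenerates_zero hμ0)
  have hν0 : ν ≠ 0 := by
    rintro rfl
    exact hν.2 ⟨_, ⟨hk, hiso⟩, properlyDegenerates_zero (model_ne_zero hn k)⟩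
  obtain ⟨ρ, hρ⟩ := exists_directlyDegenerates (properlyDegenerates_zero hν0)
  have := two_le_level hν hρ
  rw [h] at this
  exact absurd this (by norm_num)

end AlgLaw

theorem theorem2 (n : ℕ) (hn : 3 ≤ n) :
    (∀ A : AlgLaw n, AlgLaw.level A = 1 ↔
      (AlgLaw.Isomorphic A (AlgLaw.pMinus n) ∨
        AlgLaw.Isomorphic A (AlgLaw.n3MinusSum n) ∨
        AlgLaw.Isomorphic A (AlgLaw.lambda2Sum n) ∨
        ∃ α : ℂ, AlgLaw.Isomorphic A (AlgLaw.nu n α))) ∧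
    (∀ k l : AlgLaw.Kind, k ≠ l →
      ¬ AlgLaw.Degenerates (AlgLaw.model n k) (AlgLaw.model n l)) ∧
    AlgLaw.zariskiClosure (AlgLaw.orbit (AlgLaw.pMinus n)) =
      AlgLaw.orbit (AlgLaw.pMinus n) ∪ {AlgLaw.abelian n} ∧
    (∀ α : ℂ, AlgLaw.zariskiClosure (AlgLaw.orbit (AlgLaw.nu n α)) =
      AlgLaw.orbit (AlgLaw.nu n α) ∪ {AlgLaw.abelian n}) := by
  have hn0 : 0 < n := by omega
  refine ⟨fun A => (AlgLaw.level_eq_one_iff hn).trans ⟨?_, ?_⟩,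
    fun k l hkl => AlgLaw.not_degenerates_model hn hkl, ?_, fun α => ?_⟩
  · rintro ⟨k | k | k | α, h⟩
    · exact Or.inl h
    · exact Or.inr (Or.inl h)
    · exact Or.inr (Or.inr (Or.inl h))
    · exact Or.inr (Or.inr (Or.inr ⟨α, h⟩))
  · rintro (h | h | h | ⟨α, h⟩)
    · exact ⟨AlgLaw.Kind.p, h⟩
    · exact ⟨AlgLaw.Kind.n3, h⟩
    · exact ⟨AlgLaw.Kind.lam2, h⟩
    · exact ⟨AlgLaw.Kind.nu α, h⟩
  · rw [AlgLaw.pMinus_eq hn0]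
    exact AlgLaw.zariskiClosure_orbit_lineLaw _ _ (AlgLaw.proj_ne_zero _)
  · rw [AlgLaw.nu_eq hn0]
    exact AlgLaw.zariskiClosure_orbit_lineLaw _ _ (AlgLaw.proj_ne_zero _)
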